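/- Let $d\in\mathbb{N}$ and let $\vec\varphi=(\vec\varphi^1,\dots,\vec\varphi^d)$ be probability measures on $\mathbb{Z}_+^d$; write $\vec\xi^i=(\xi^{i,1},\dots,\xi^{i,d})\sim\vec\varphi^i$. Assume that $\vec\varphi$ is (sub)critical: the means $M_{i,j}=\mathbb{E}[\xi^{i,j}]$ are finite, the spectral radius of $M=(M_{i,j})$ is at most $1$, and $\mathbb{P}(\xi^{i,i}=1)<1$ for every $i\in[d]$. (If $M$ is irreducible, the last condition follows from the first two and $\mathbb{P}(\sum_j\xi^{i,j}=1)<1$ for some $i$.) Let $\vec r\in\mathbb{Z}_+^d\setminus\{\vec 0\}$. Let $F$ be a multitype Bienaymé-Galton-Watson plane forest with offspring distribution $\vec\varphi$ and $r_j$ roots of type $j$ for each $j\in[d]$: given $F$ up to generation $n$, the vectors $\vec\chi(v)=(\chi^1(v),\dots,\chi^d(v))$ of the numbers of children of each type of the vertices $v$ of generation $n$ are independent, with $\vec\chi(v)\sim\vec\varphi^i$ if $v$ has type $i$. A type $i$ subtree of $F$ is a maximal connected subgraph of $F$ whose vertices all have type $i$. The reduced forest $F^{\tt red}$ is obtained from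 $F$ by collapsing every such subtree to one vertex of type $i$, keeping the edges between different subtrees; the height ${\rm hgt}$ of a vertex of $F^{\tt red}$ is its graph distance to the root of its tree in $F^{\tt red}$, and the reduced height of a vertex of $F$ is the height in $F^{\tt red}$ of the vertex into which it is collapsed. Let $(\vec\xi^i_k;\,i\in[d],k\ge1)$ be independent with $\vec\xi^i_k\sim\vec\varphi^i$, and define the coding walks $\vec X^i(m)=(X^{i,1}(m),\dots,X^{i,d}(m))=\sum_{k=1}^m(\vec\xi^i_k-\vec\epsilon_i)$, where $\vec\epsilon_i$ is the $i$-th unit vector, and $\tau^i(m)=\min\{k\ge0: X^{i,i}(k)=-m\}$. For $j\in[d]$ and $h\ge0$ define recursively $$R^{(0),j}=r_j,\qquad R^{(h+1),j}=r_j+\sum_{\ell\ne j}X^{\ell,j}\big(\tau^\ell(R^{(h),\ell})\big),\qquad U^{(h),j}=\tau^j(R^{(h),j}).$$ Then almost surely $\tau^i(m)<\infty$ for all $i\in[d]$ and $m\ge0$, almost surely the sets below are finite for all $j$ and $h$, and, jointly over $j\in[d]$ and $h\ge0$, $$\Big(\#\{v\in F^{\tt red}:{\tt TYPE}(v)=j,\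 {\rm hgt}(v)\le h\},\ \#\{v\in F:{\tt TYPE}(v)=j,\ v\text{ has reduced height}\le h\}\Big)_{j,h}\ \overset{d}{=}\ \big(R^{(h),j},\,U^{(h),j}\big)_{j,h}.$$ -/

import Mathlib

open MeasureTheory ProbabilityTheory

/-- A (locally finite) multitype plane forest with types in `Fin d`, in Ulam-Harris coding.
A label is a list of natural numbers, most recent index first: `[k]` is the `k`-th root and
`k :: v` is the `k`-th child of `v`. The forest is described by the ordered list of the types of
its roots and, for each vertex, the ordered list of the types of its children
(the values of `childTypes` at labels which are not vertices play no role). -/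
structure MForest (d : ℕ) where
  rootTypes : List (Fin d)
  childTypes : List ℕ → List (Fin d)

namespace MForest

variable {d : ℕ}

/-- `F.HasType v i`: the label `v` is a vertex of `F`, and its type is `i`. -/
inductive HasType (F : MForest d) : List ℕ → Fin d → Prop
  | root (k : ℕ) (i : Fin d) : F.rootTypes[k]? = some i → HasType F [k] i
  | child (v : List ℕ) (i : Fin d) (k : ℕ) (j : Fin d) :
      HasType F v i → (F.childTypes v)[k]? = some j → HasType F (k :: v) j

/-- The vertices of `F` (each label recorded together with its type). -/
def Vertex (F : MForest d) : Type := {x : List ℕ × Fin d // F.HasType x.1 x.2}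

variable {F : MForest d}

/-- The Ulam-Harris label of a vertex; its length is the height of the vertex plus one. -/
def Vertex.label (v : F.Vertex) : List ℕ := v.1.1

/-- The type of a vertex. -/
def Vertex.type (v : F.Vertex) : Fin d := v.1.2

/-- `v` is a root of one of the trees of the forest. -/
def Vertex.IsRoot (v : F.Vertex) : Prop := v.label.length = 1

/-- `u` is the parent of `v`. -/
def Vertex.IsParent (u v : F.Vertex) : Prop := ∃ k : ℕ, v.label = k :: u.label

/-- The child vector of the vertex labelled `v`: coordinate `j` is its number of type `j`
children. -/
def childVector (F : MForest d) (v : List ℕ) : Fin d → ℕ := fun j => (F.childTypes v).count j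

/-- The graph of the edges of `F` which join vertices of equal type. -/
def monoGraph (F : MForest d) : SimpleGraph F.Vertex :=
  SimpleGraph.fromRel fun u v => u.IsParent v ∧ u.type = v.type

/-- The typed subtrees of `F`: the maximal connected subgraphs all of whose vertices have the
same type. They are the vertices of the reduced forest. -/
def Subtree (F : MForest d) : Type := F.monoGraph.ConnectedComponent

/-- The typed subtree containing a given vertex. -/
def Vertex.subtree (v : F.Vertex) : F.Subtree := F.monoGraph.connectedComponentMk v

theorem type_eq_of_walk {u v : F.Vertex} (p : F.monoGraph.Walk u v) : u.type = v.type := by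
  induction p with
  | nil => rfl
  | cons h _ ih =>
    refine Eq.trans ?_ ih
    rcases h.2 with h | h
    · exact h.2
    · exact h.2.symm

/-- The type of a vertex of the reduced forest: the common type of the vertices of `F` collapsed
into it. -/
def Subtree.type (C : F.Subtree) : Fin d :=
  SimpleGraph.ConnectedComponent.lift (fun v : F.Vertex => v.type)
    (fun _ _ p _ => type_eq_of_walk p) C

/-- The reduced forest: every typed subtree is collapsed to a single vertex and the edges between
different typed subtrees are retained. -/
def reducedGraph (F : MForest d) : SimpleGraph F.Subtree :=
  SimpleGraph.fromRel fun C D =>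
    ∃ u v : F.Vertex, u.subtree = C ∧ v.subtree = D ∧ u.IsParent v

/-- A root of the reduced forest: a typed subtree which contains a root of `F`. -/
def Subtree.IsRoot (C : F.Subtree) : Prop := ∃ v : F.Vertex, v.IsRoot ∧ v.subtree = C

/-- The height of a vertex of the reduced forest: the graph distance, in the reduced forest, to
the root of its tree (roots of the other trees are at distance `⊤`). -/
noncomputable def Subtree.height (C : F.Subtree) : ℕ∞ :=
  ⨅ (ρ : F.Subtree) (_ : ρ.IsRoot), F.reducedGraph.edist ρ C

/-- The reduced height of a vertex of `F`. -/
noncomputable def Vertex.reducedHeight (v : F.Vertex) : ℕ∞ := v.subtree.height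

/-- The vertices of type `j` and height at most `h` of the reduced forest. -/
def reducedUpTo (F : MForest d) (h : ℕ) (j : Fin d) : Set F.Subtree :=
  {C | C.type = j ∧ C.height ≤ h}

/-- The vertices of `F` of type `j` and reduced height at most `h`. -/
def verticesUpTo (F : MForest d) (h : ℕ) (j : Fin d) : Set F.Vertex :=
  {v | v.type = j ∧ v.reducedHeight ≤ h}

/-- `F` coincides with `t` up to generation `n` (types included): same roots, and same ordered
children for the vertices of generation `< n`. -/
def AgreeUpTo (F t : MForest d) (n : ℕ) : Prop :=
  F.rootTypes = t.rootTypes ∧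
    ∀ v : t.Vertex, v.label.length ≤ n → F.childTypes v.label = t.childTypes v.label

end MForest

/-- The random forest `F` is a multitype Bienaymé-Galton-Watson forest with offspring
distribution `φ` and `r j` roots of type `j`: given the forest up to generation `n`, the child
vectors of the vertices of generation `n` are independent, the child vector of a type `i` vertex
having law `φ i`. The planar order among siblings of different types is left arbitrary. -/
structure IsMBGWForest {d : ℕ} {Ω : Type*} [MeasurableSpace Ω] (P : Measure Ω)
    (φ : Fin d → Measure (Fin d → ℕ)) (r : Fin d → ℕ) (F : Ω → MForest d) : Prop where
  measurable : ∀ v i, MeasurableSet {ω | (F ω).HasType v i}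
  roots : ∀ᵐ ω ∂P, ∀ j, (F ω).rootTypes.count j = r j
  branching : ∀ (n : ℕ) (t : MForest d) (x : List ℕ → Fin d → ℕ),
    P {ω | (F ω).AgreeUpTo t n ∧
        ∀ v : t.Vertex, v.label.length = n + 1 → (F ω).childVector v.label = x v.label} =
      P {ω | (F ω).AgreeUpTo t n} *
        ∏ᶠ v ∈ {v : t.Vertex | v.label.length = n + 1}, φ v.type {x v.label}

/-- The mean matrix of an offspring distribution. -/
noncomputable def meanMatrix {d : ℕ} (φ : Fin d → Measure (Fin d → ℕ)) :
    Matrix (Fin d) (Fin d) ℝ :=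
  Matrix.of fun i j => ∫ x, (x j : ℝ) ∂(φ i)

/-- (Sub)criticality: the means are finite, the Perron-Frobenius eigenvalue (spectral radius) of
the mean matrix is at most one, and no type almost surely produces exactly one child of its own
type. When the mean matrix is irreducible, the last condition follows from the first two as soon
as the total number of children of some type is not almost surely one. -/
structure IsSubcritical {d : ℕ} (φ : Fin d → Measure (Fin d → ℕ)) : Prop where
  integrable : ∀ i j, Integrable (fun x : Fin d → ℕ => (x j : ℝ)) (φ i)
  spectralRadius_le : spectralRadius ℂ ((meanMatrix φ).map (fun a : ℝ => (a : ℂ))) ≤ 1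
  nondegenerate : ∀ i, φ i {x | x i = 1} < 1

namespace CodingWalk

variable {d : ℕ}

/-- The coordinate `X^{i,j}` of the `i`-th coding walk with steps `ξ i k - ε_i`. -/
def X (ξ : Fin d → ℕ → Fin d → ℕ) (i j : Fin d) (m : ℕ) : ℤ :=
  ∑ k ∈ Finset.range m, ((ξ i k j : ℤ) - if i = j then 1 else 0)

/-- `τ^i(m) = min {k : X^{i,i}(k) = -m}` (meaningful when this set is nonempty). -/
noncomputable def tau (ξ : Fin d → ℕ → Fin d → ℕ) (i : Fin d) (m : ℤ) : ℕ :=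
  sInf {k : ℕ | X ξ i i k = -m}

/-- `R^{(0),j} = r_j` and
`R^{(h+1),j} = r_j + ∑_{ℓ ≠ j} X^{ℓ,j}(τ^ℓ(R^{(h),ℓ}))`. -/
noncomputable def R (ξ : Fin d → ℕ → Fin d → ℕ) (r : Fin d → ℕ) : ℕ → Fin d → ℤ
  | 0, j => r j
  | h + 1, j => r j + ∑ l ∈ Finset.univ.filter (fun l => l ≠ j), X ξ l j (tau ξ l (R ξ r h l))

/-- `U^{(h),j} = τ^j(R^{(h),j})`. -/
noncomputable def U (ξ : Fin d → ℕ → Fin d → ℕ) (r : Fin d → ℕ) (h : ℕ) (j : Fin d) : ℕ :=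
  tau ξ j (R ξ r h j)

end CodingWalk

/-!
The forest and the walks are compared through a third description. Forget the planar order between
siblings of different types and label a vertex by the list of pairs `(type, rank among the siblings
of that type)` along its ancestral line (`Label`). A forest becomes a set of labels (`Label.tree`)
which is determined by the child vectors of its elements; the type, the reduced height
(`Label.redHeight`) and the property of being the first vertex of its typed subtree
(`Label.IsTop`) can be read off the label alone. The counts of the theorem are thus numbers of
labels: for `F` this is `MForest.reducedUpTo_of_tree_eq` and `MForest.verticesUpTo_of_tree_eq`.

Fix `H` and a finite set `S` of labels which can be the part of the forest consisting of the vertices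
of reduced height at most `H` and their children (`Label.IsExplored`).
* The probability that this part of the random forest equals `S` is the product `Label.weight` of
  the probabilities of the child vectors prescribed by `S`. The branching property gives this
  for the first generations, jointly with the product measure of independent child vectors indexed
  by labels, and that is enough as `S` meets finitely many generations
  (`IsMBGWForest.measurableSet_and_measure_tree_eq`).
* Enumerate the vertices of each type in `S` along an order in which the reduced height is monotone
  and parents precede their children (`Label.key`), and let `Label.Reads` be the event that the
  steps of the walks are the child vectors of `S` in this order. By independence it has the
  same probability (`Label.measure_reads`), and these events are disjoint for different `S`
  (`Label.IsExplored.eq_of_reads`): the walks decode `S`.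
* On that event `R` and `U` are the counts of `S` (`Label.IsExplored.R_eq`,
  `Label.IsExplored.U_eq`): after the `k` first vertices of type `j`, the walk `X^{j,j}` plus the
  number of typed subtrees is the number of discovered vertices which are yet to be explored, and
  it vanishes for the first time when there is no vertex left.

The probabilities of the sets `S` add up to one (`Label.tsum_weight_eq_one`) because typed subtrees
are almost surely finite. Indeed the mean `M_{i,i}` is at most the spectral radius of `M`, by
Gelfand's formula, hence at most one. For a branching process with such a mean, whose offspring is
not almost surely one, the extinction probability is a fixed point in `[0, 1]` of the generating
function, and the only one is `1` (`eq_one_of_integral_pow_eq`). Matching the two partitions gives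
the equality of laws. The finiteness of the hitting time of `-m` by `X^{i,i}` is the case `H = 0` of
the same decomposition, for `m` roots of each type.
-/

open scoped ENNReal NNReal

/-! ### Labels and trees -/

/-- Labels of the vertices of a forest up to the planar order between siblings of different types:
`(j, k) :: c` is the `k`-th child of type `j` of `c`. The empty list is a virtual vertex, the parent
of all roots, so that `[(j, k)]` is the `k`-th root of type `j`. -/
abbrev Label (d : ℕ) : Type := List (Fin d × ℕ)

namespace Label

variable {d : ℕ}

/-- The type of a vertex, `none` for the virtual vertex `[]`. -/
def type (c : Label d) : Option (Fin d) := c.head?.map Prod.fst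

@[simp] theorem type_nil : type ([] : Label d) = none := rfl

@[simp] theorem type_cons (a : Fin d × ℕ) (c : Label d) : type (a :: c) = some a.1 := rfl

/-- The reduced height of a vertex: the number of type changes along its ancestral line. The step
from the virtual vertex to a root does not count. -/
def redHeight : Label d → ℕ
  | [] => 0
  | a :: c => redHeight c + if type c = none ∨ type c = some a.1 then 0 else 1

/-- The vertex is the first one of its typed subtree: a root, or the child of a vertex of another
type. -/
def IsTop : Label d → Prop
  | [] => False
  | a :: c => type c ≠ some a.1

theorem redHeight_le_cons (a : Fin d × ℕ) (c : Label d) : redHeight c ≤ redHeight (a :: c) :=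
  Nat.le_add_right _ _

theorem redHeight_cons_le (a : Fin d × ℕ) (c : Label d) :
    redHeight (a :: c) ≤ redHeight c + 1 := by
  rw [redHeight]; split_ifs <;> omega

theorem redHeight_cons_of_type_eq {a : Fin d × ℕ} {c : Label d} (h : type c = some a.1) :
    redHeight (a :: c) = redHeight c := by
  simp [redHeight, h]

theorem redHeight_cons_of_ne {a : Fin d × ℕ} {c : Label d} {i : Fin d} (h : type c = some i)
    (hi : i ≠ a.1) : redHeight (a :: c) = redHeight c + 1 := by
  simp [redHeight, h, hi]

theorem type_eq_none_iff {c : Label d} : type c = none ↔ c = [] := by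
  cases c <;> simp

/-- Membership in the tree with child vectors `ζ` in which only the vertices satisfying `p` are given
their children. -/
def InTree (p : Label d → Prop) (ζ : Label d → Fin d → ℕ) : Label d → Prop
  | [] => True
  | a :: c => InTree p ζ c ∧ p c ∧ a.2 < ζ c a.1

/-- The tree with child vectors `ζ` in which only the vertices satisfying `p` are given their
children. Taking `p` true gives the whole forest; restricting the length or the reduced height
truncates it. -/
def tree (p : Label d → Prop) (ζ : Label d → Fin d → ℕ) : Set (Label d) := {c | InTree p ζ c}

variable {p q : Label d → Prop} {ζ ζ' : Label d → Fin d → ℕ} {S : Finset (Label d)}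

@[simp] theorem nil_mem_tree : [] ∈ tree p ζ := trivial

theorem cons_mem_tree {a : Fin d × ℕ} {c : Label d} :
    a :: c ∈ tree p ζ ↔ c ∈ tree p ζ ∧ p c ∧ a.2 < ζ c a.1 := Iff.rfl

/-- The child vectors of the vertices which are given children determine the tree. -/
theorem tree_congr (h : ∀ c ∈ tree p ζ, p c → ζ c = ζ' c) : tree p ζ = tree p ζ' := by
  ext c
  induction c with
  | nil => simp
  | cons a c ih =>
    rw [cons_mem_tree, cons_mem_tree, ← ih]
    refine and_congr_right fun h1 => and_congr_right fun h2 => ?_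
    rw [h c h1 h2]

open Classical in
/-- The child vector of `c` in a finite set of labels. -/
noncomputable def childCount (S : Finset (Label d)) (c : Label d) (j : Fin d) : ℕ :=
  (S.filter fun e => ∃ k, e = (j, k) :: c).card

theorem childCount_eq (h : tree p ζ = S) {c : Label d} (hc : c ∈ S) (hp : p c) :
    childCount S c = ζ c := by
  classical
  funext j
  have : (S.filter fun e => ∃ k, e = (j, k) :: c)
      = (Finset.range (ζ c j)).image fun k => (j, k) :: c := by
    ext e
    simp only [Finset.mem_filter, Finset.mem_image, Finset.mem_range]
    constructor
    · rintro ⟨he, k, rfl⟩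
      have : (j, k) :: c ∈ tree p ζ := by rw [h]; exact he
      exact ⟨k, this.2.2, rfl⟩
    · rintro ⟨k, hk, rfl⟩
      refine ⟨?_, k, rfl⟩
      have : (j, k) :: c ∈ tree p ζ := ⟨by show c ∈ tree p ζ; rw [h]; exact hc, hp, hk⟩
      rw [h] at this; exact this
  rw [childCount, this, Finset.card_image_of_injective _ (fun a b hab => by simpa using hab),
    Finset.card_range]

/-- The tree is the finite set `S` if and only if `S` is a possible tree and the child vectors are the
ones prescribed by `S`; the second condition concerns finitely many values of `ζ`. -/
theorem tree_eq_iff :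
    tree p ζ = S ↔ tree p (childCount S) = S ∧ ∀ c ∈ S, p c → ζ c = childCount S c := by
  constructor
  · intro h
    have h2 : ∀ c ∈ S, p c → ζ c = childCount S c := fun c hc hp => (childCount_eq h hc hp).symm
    refine ⟨?_, h2⟩
    rw [← tree_congr (ζ := ζ), h]
    intro c hc
    exact h2 c (by rw [h] at hc; exact hc)
  · rintro ⟨h1, h2⟩
    rw [← h1]
    symm
    apply tree_congr
    intro c hc hp
    exact (h2 c (by rw [h1] at hc; exact hc) hp).symm

theorem tree_mono (h : ∀ c, p c → q c) : tree p ζ ⊆ tree q ζ := by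
  intro c
  induction c with
  | nil => simp
  | cons a c ih => exact fun hc => ⟨ih hc.1, h c hc.2.1, hc.2.2⟩

/-! ### The exploration order -/

/-- The exploration order compares reduced heights, then lengths; the encoding breaks ties. -/
def key (c : Label d) : ℕ ×ₗ ℕ ×ₗ ℕ := toLex (redHeight c, toLex (c.length, Encodable.encode c))

theorem key_injective : Function.Injective (key (d := d)) := by
  intro a b h
  simp only [key, EmbeddingLike.apply_eq_iff_eq, Prod.mk.injEq] at h
  exact Encodable.encode_injective h.2.2

theorem key_lt_cons (a : Fin d × ℕ) (c : Label d) : key c < key (a :: c) := by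
  rw [key, key, Prod.Lex.toLex_lt_toLex]
  rcases (redHeight_le_cons a c).lt_or_eq with h | h
  · exact Or.inl h
  · refine Or.inr ⟨h, ?_⟩
    rw [Prod.Lex.toLex_lt_toLex]
    left; simp

theorem redHeight_le_of_key_le {c e : Label d} (h : key c ≤ key e) :
    redHeight c ≤ redHeight e := by
  rw [key, key, Prod.Lex.toLex_le_toLex] at h
  rcases h with h | h
  · exact h.le
  · exact h.1.le

/-- The number of vertices of `S` with the same type as `c` which are explored before `c`. -/
noncomputable def rank (S : Finset (Label d)) (c : Label d) : ℕ :=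
  (S.filter fun e => type e = type c ∧ key e < key c).card

theorem rank_lt_rank {c e : Label d} (hc : c ∈ S) (ht : type c = type e) (h : key c < key e) :
    rank S c < rank S e := by
  apply Finset.card_lt_card
  rw [Finset.ssubset_iff_of_subset]
  · exact ⟨c, by simp [hc, ht, h], by simp⟩
  · intro x
    simp only [Finset.mem_filter]
    rintro ⟨h1, h2, h3⟩
    exact ⟨h1, h2.trans ht, h3.trans h⟩

theorem rank_inj {c e : Label d} (hc : c ∈ S) (he : e ∈ S) (ht : type c = type e)
    (h : rank S c = rank S e) : c = e := by
  rcases lt_trichotomy (key c) (key e) with h' | h' | h'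
  · exact absurd h (rank_lt_rank hc ht h').ne
  · exact key_injective h'
  · exact absurd h (rank_lt_rank he ht.symm h').ne'

/-- `I` consists of the first vertices of type `j` in the exploration of `S`. -/
def IsInitial (S I : Finset (Label d)) (j : Fin d) : Prop :=
  I ⊆ S ∧ (∀ c ∈ I, type c = some j) ∧
    ∀ c ∈ I, ∀ e ∈ S, type e = some j → key e < key c → e ∈ I

theorem IsInitial.image_rank {I : Finset (Label d)} {j : Fin d} (h : IsInitial S I j) :
    I.image (rank S) = Finset.range I.card := by
  apply Finset.eq_of_subset_of_card_le
  · intro n hn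
    obtain ⟨c, hc, rfl⟩ := Finset.mem_image.1 hn
    rw [Finset.mem_range]
    apply Finset.card_lt_card
    rw [Finset.ssubset_iff_of_subset]
    · exact ⟨c, hc, by simp⟩
    · intro e
      simp only [Finset.mem_filter]
      rintro ⟨h1, h2, h3⟩
      exact h.2.2 c hc e h1 (h2.trans (h.2.1 c hc)) h3
  · rw [Finset.card_range, Finset.card_image_of_injOn]
    intro c hc e he hce
    exact rank_inj (h.1 hc) (h.1 he) ((h.2.1 c hc).trans (h.2.1 e he).symm) hce

theorem IsInitial.sum_range {I : Finset (Label d)} {j : Fin d} (h : IsInitial S I j)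
    {M : Type*} [AddCommMonoid M] (f : ℕ → M) :
    ∑ k ∈ Finset.range I.card, f k = ∑ c ∈ I, f (rank S c) := by
  rw [← h.image_rank, Finset.sum_image]
  intro c hc e he hce
  exact rank_inj (h.1 hc) (h.1 he) ((h.2.1 c hc).trans (h.2.1 e he).symm) hce

theorem IsInitial.exists_card_eq {I : Finset (Label d)} {j : Fin d} (h : IsInitial S I j)
    {k : ℕ} (hk : k ≤ I.card) : ∃ J ⊆ I, IsInitial S J j ∧ J.card = k := by
  have hinj : Set.InjOn (rank S) I := fun c hc e he hce =>
    rank_inj (h.1 hc) (h.1 he) ((h.2.1 c hc).trans (h.2.1 e he).symm) hce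
  refine ⟨I.filter fun c => rank S c < k, Finset.filter_subset _ _, ⟨?_, ?_, ?_⟩, ?_⟩
  · exact (Finset.filter_subset _ _).trans h.1
  · intro c hc; exact h.2.1 c (Finset.mem_filter.1 hc).1
  · intro c hc e he ht hke
    rw [Finset.mem_filter] at hc ⊢
    exact ⟨h.2.2 c hc.1 e he ht hke,
      (rank_lt_rank he (ht.trans (h.2.1 c hc.1).symm) hke).trans hc.2⟩
  · rw [← Finset.card_image_of_injOn (hinj.mono fun x hx => (Finset.mem_filter.1 hx).1)]
    refine Eq.trans ?_ (Finset.card_range k)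
    congr 1
    ext n
    simp only [Finset.mem_image, Finset.mem_filter, Finset.mem_range]
    constructor
    · rintro ⟨c, ⟨_, h2⟩, rfl⟩; exact h2
    · intro hn
      have : n ∈ I.image (rank S) := by
        rw [h.image_rank, Finset.mem_range]; omega
      obtain ⟨c, hc, rfl⟩ := Finset.mem_image.1 this
      exact ⟨c, ⟨hc, hn⟩, rfl⟩

end Label

/-! ### Counts read from the walks -/

namespace Label

variable {d : ℕ} {S : Finset (Label d)}

open Classical in
/-- The vertices of type `j` and reduced height at most `h`. -/
noncomputable def verts (S : Finset (Label d)) (h : ℕ) (j : Fin d) : Finset (Label d) :=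
  S.filter fun c => type c = some j ∧ redHeight c ≤ h

open Classical in
/-- The first vertices of the typed subtrees of type `j` and reduced height at most `h`. -/
noncomputable def tops (S : Finset (Label d)) (h : ℕ) (j : Fin d) : Finset (Label d) :=
  S.filter fun c => type c = some j ∧ redHeight c ≤ h ∧ IsTop c

theorem mem_verts {h : ℕ} {j : Fin d} {c : Label d} :
    c ∈ verts S h j ↔ c ∈ S ∧ type c = some j ∧ redHeight c ≤ h := by
  simp [verts]

theorem mem_tops {h : ℕ} {j : Fin d} {c : Label d} :
    c ∈ tops S h j ↔ c ∈ S ∧ type c = some j ∧ redHeight c ≤ h ∧ IsTop c := by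
  simp [tops]

theorem isInitial_verts (h : ℕ) (j : Fin d) : IsInitial S (verts S h j) j := by
  refine ⟨Finset.filter_subset _ _, fun c hc => (mem_verts.1 hc).2.1, fun c hc e he ht hk => ?_⟩
  exact mem_verts.2 ⟨he, ht, (redHeight_le_of_key_le hk.le).trans (mem_verts.1 hc).2.2⟩

open Classical in
/-- The children of type `j` in `S` of the vertices in `I`. -/
noncomputable def childrenOf (S I : Finset (Label d)) (j : Fin d) : Finset (Label d) :=
  S.filter fun e => ∃ c ∈ I, ∃ k, e = (j, k) :: c

theorem mem_childrenOf {I : Finset (Label d)} {j : Fin d} {e : Label d} :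
    e ∈ childrenOf S I j ↔ e ∈ S ∧ ∃ c ∈ I, ∃ k, e = (j, k) :: c := by
  simp [childrenOf]

theorem card_childrenOf (I : Finset (Label d)) (j : Fin d) :
    (childrenOf S I j).card = ∑ c ∈ I, childCount S c j := by
  classical
  have : childrenOf S I j = I.biUnion fun c => S.filter fun e => ∃ k, e = (j, k) :: c := by
    ext e
    simp only [mem_childrenOf, Finset.mem_biUnion, Finset.mem_filter]
    tauto
  rw [this, Finset.card_biUnion]
  · simp only [childCount]
  · intro a _ b _ hab
    rw [Function.onFun, Finset.disjoint_left]
    intro e he he'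
    obtain ⟨k, rfl⟩ := (Finset.mem_filter.1 he).2
    obtain ⟨k', h⟩ := (Finset.mem_filter.1 he').2
    simp only [List.cons.injEq] at h
    exact hab h.2

/-- `S` is the set of the vertices of reduced height at most `H` and of their children, in some forest
with `r j` roots of type `j`. -/
def IsExplored (r : Fin d → ℕ) (H : ℕ) (S : Finset (Label d)) : Prop :=
  tree (fun c => redHeight c ≤ H) (childCount S) = S ∧ childCount S [] = r

/-- The steps of the walks are the child vectors of the vertices of `S` of reduced height at most `H`,
in the exploration order. -/
def Reads (ξ : Fin d → ℕ → Fin d → ℕ) (H : ℕ) (S : Finset (Label d)) : Prop :=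
  ∀ c ∈ S, redHeight c ≤ H → ∀ i, type c = some i → ξ i (rank S c) = childCount S c

variable {ξ : Fin d → ℕ → Fin d → ℕ} {r : Fin d → ℕ} {H : ℕ}

theorem IsExplored.nil_mem (hS : IsExplored r H S) : [] ∈ S := by
  have : [] ∈ tree (fun c => redHeight c ≤ H) (childCount S) := nil_mem_tree
  rw [hS.1] at this; exact this

theorem IsExplored.parent_mem (hS : IsExplored r H S) {a : Fin d × ℕ} {c : Label d}
    (h : a :: c ∈ S) : c ∈ S ∧ redHeight c ≤ H := by
  have : a :: c ∈ tree (fun c => redHeight c ≤ H) (childCount S) := by rw [hS.1]; exact h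
  have h1 := this.1
  refine ⟨?_, this.2.1⟩
  have h2 : c ∈ tree (fun c => redHeight c ≤ H) (childCount S) := h1
  rw [hS.1] at h2; exact h2

theorem X_card_eq (hx : Reads ξ H S) {I : Finset (Label d)} {i : Fin d}
    (hI : IsInitial S I i) (hH : ∀ c ∈ I, redHeight c ≤ H) (j : Fin d) :
    CodingWalk.X ξ i j I.card
      = (childrenOf S I j).card - if i = j then (I.card : ℤ) else 0 := by
  rw [CodingWalk.X, hI.sum_range fun k => ((ξ i k j : ℤ) - if i = j then 1 else 0),
    Finset.sum_sub_distrib, card_childrenOf]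
  congr 1
  · push_cast
    refine Finset.sum_congr rfl fun c hc => ?_
    rw [hx c (hI.1 hc) (hH c hc) i (hI.2.1 c hc)]
  · split_ifs <;> simp

theorem IsExplored.verts_eq (hS : IsExplored r H S) (h : ℕ) (j : Fin d) :
    verts S h j = tops S h j ∪ childrenOf S (verts S h j) j := by
  classical
  ext e
  rw [Finset.mem_union, mem_verts, mem_tops, mem_childrenOf]
  constructor
  · rintro ⟨h1, h2, h3⟩
    cases e with
    | nil => simp at h2
    | cons a c =>
      by_cases ht : type c = some a.1
      · right
        refine ⟨h1, c, mem_verts.2 ⟨(hS.parent_mem h1).1, ?_, ?_⟩, a.2, ?_⟩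
        · rw [ht, ← h2, type_cons]
        · exact (redHeight_le_cons a c).trans h3
        · simp only [type_cons, Option.some.injEq] at h2
          rw [← h2]
      · exact Or.inl ⟨h1, h2, h3, ht⟩
  · rintro (h1 | ⟨h1, c, hc, k, rfl⟩)
    · exact ⟨h1.1, h1.2.1, h1.2.2.1⟩
    · refine ⟨h1, rfl, ?_⟩
      rw [redHeight_cons_of_type_eq (mem_verts.1 hc).2.1]
      exact (mem_verts.1 hc).2.2

theorem disjoint_tops_childrenOf {I : Finset (Label d)} {h : ℕ} {j : Fin d}
    (hI : ∀ c ∈ I, type c = some j) : Disjoint (tops S h j) (childrenOf S I j) := by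
  rw [Finset.disjoint_left]
  intro e he he'
  obtain ⟨_, c, hc, k, rfl⟩ := mem_childrenOf.1 he'
  exact (mem_tops.1 he).2.2.2 (hI c hc)

theorem IsExplored.X_card_verts (hS : IsExplored r H S) (hx : Reads ξ H S) {h : ℕ} (hh : h ≤ H)
    (j : Fin d) : CodingWalk.X ξ j j (verts S h j).card = -((tops S h j).card : ℤ) := by
  rw [X_card_eq hx (isInitial_verts h j) (fun c hc => (mem_verts.1 hc).2.2.trans hh), if_pos rfl]
  have h1 := congrArg Finset.card (hS.verts_eq h j)
  rw [Finset.card_union_of_disjoint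
    (disjoint_tops_childrenOf fun c hc => (mem_verts.1 hc).2.1)] at h1
  omega

/-- The walk does not reach minus the number of typed subtrees before all of their vertices are
explored. -/
theorem IsExplored.X_ne_of_lt (hS : IsExplored r H S) (hx : Reads ξ H S) {h : ℕ} (hh : h ≤ H)
    (j : Fin d) {k : ℕ} (hk : k < (verts S h j).card) :
    CodingWalk.X ξ j j k ≠ -((tops S h j).card : ℤ) := by
  classical
  obtain ⟨J, hJ, hJi, rfl⟩ := (isInitial_verts (S := S) h j).exists_card_eq hk.le
  rw [X_card_eq hx hJi (fun c hc => (mem_verts.1 (hJ hc)).2.2.trans hh), if_pos rfl]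
  have hdisj : Disjoint (tops S h j) (childrenOf S J j) := disjoint_tops_childrenOf hJi.2.1
  -- the first unexplored vertex has all its ancestors of the same type in `J`
  have hlt : J.card < (tops S h j ∪ childrenOf S J j).card := by
    obtain ⟨c, hc, hcmin⟩ := Finset.exists_min_image (verts S h j \ J) key (by
      rw [Finset.sdiff_nonempty]
      intro hle
      exact absurd (Finset.card_le_card hle) (by omega))
    rw [Finset.mem_sdiff] at hc
    have hmem : ∀ e ∈ verts S h j, (∀ e' ∈ verts S h j, key e' < key e → e' ∈ J) →
        e ∈ tops S h j ∪ childrenOf S J j := by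
      intro e he he'
      have he2 := he
      rw [hS.verts_eq h j, Finset.mem_union] at he2
      rw [Finset.mem_union]
      refine he2.imp_right fun h3 => ?_
      obtain ⟨h4, c', hc', k, rfl⟩ := mem_childrenOf.1 h3
      exact mem_childrenOf.2 ⟨h4, c', he' c' hc' (key_lt_cons _ _), k, rfl⟩
    have hsub : insert c J ⊆ tops S h j ∪ childrenOf S J j := by
      intro e he
      rcases Finset.mem_insert.1 he with rfl | he
      · refine hmem _ hc.1 fun e' he' hlt => ?_
        by_contra hn
        exact absurd (hcmin e' (Finset.mem_sdiff.2 ⟨he', hn⟩)) (not_le.2 hlt)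
      · exact hmem _ (hJ he) fun e' he' hlt =>
          hJi.2.2 e he e' (mem_verts.1 he').1 (mem_verts.1 he').2.1 hlt
    have := Finset.card_le_card hsub
    rw [Finset.card_insert_of_notMem hc.2] at this
    omega
  rw [Finset.card_union_of_disjoint hdisj] at hlt
  omega

theorem IsExplored.tau_tops (hS : IsExplored r H S) (hx : Reads ξ H S) {h : ℕ} (hh : h ≤ H)
    (j : Fin d) : CodingWalk.tau ξ j (tops S h j).card = (verts S h j).card := by
  rw [CodingWalk.tau]
  apply le_antisymm
  · exact Nat.sInf_le (hS.X_card_verts hx hh j)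
  · refine le_csInf ⟨_, hS.X_card_verts hx hh j⟩ fun k hk => ?_
    by_contra hlt
    exact hS.X_ne_of_lt hx hh j (not_le.1 hlt) hk

theorem IsExplored.tops_zero_card (hS : IsExplored r H S) (j : Fin d) :
    (tops S 0 j).card = r j := by
  have : tops S 0 j = childrenOf S {[]} j := by
    ext e
    rw [mem_tops, mem_childrenOf]
    constructor
    · rintro ⟨h1, h2, h3, h4⟩
      refine ⟨h1, [], by simp, ?_⟩
      cases e with
      | nil => simp at h2
      | cons a c =>
        cases hc : type c with
        | none =>
          rw [type_eq_none_iff] at hc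
          simp only [type_cons, Option.some.injEq] at h2
          exact ⟨a.2, by rw [hc, ← h2]⟩
        | some i =>
          have : i ≠ a.1 := by rintro rfl; exact h4 hc
          rw [redHeight_cons_of_ne hc this] at h3
          omega
    · rintro ⟨h1, c, hc, k, rfl⟩
      rw [Finset.mem_singleton] at hc
      subst hc
      exact ⟨h1, rfl, by simp [redHeight], by simp [IsTop]⟩
  rw [this, card_childrenOf, Finset.sum_singleton, hS.2]

theorem IsExplored.tops_succ_card (hS : IsExplored r H S) (h : ℕ) (j : Fin d) :
    (tops S (h + 1) j).card
      = r j + ∑ l ∈ Finset.univ.filter (fun l => l ≠ j), (childrenOf S (verts S h l) j).card := by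
  classical
  have : tops S (h + 1) j = childrenOf S {[]} j ∪
      (Finset.univ.filter (fun l => l ≠ j)).biUnion fun l => childrenOf S (verts S h l) j := by
    ext e
    simp only [mem_tops, Finset.mem_union, Finset.mem_biUnion, mem_childrenOf]
    constructor
    · rintro ⟨h1, h2, h3, h4⟩
      cases e with
      | nil => simp at h2
      | cons a c =>
        simp only [type_cons, Option.some.injEq] at h2
        cases hc : type c with
        | none =>
          rw [type_eq_none_iff] at hc
          exact Or.inl ⟨h1, [], by simp, a.2, by rw [hc, ← h2]⟩
        | some i =>
          have hi : i ≠ a.1 := by rintro rfl; exact h4 hc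
          rw [redHeight_cons_of_ne hc hi] at h3
          exact Or.inr ⟨i, by simp [← h2, hi], h1, c,
            mem_verts.2 ⟨(hS.parent_mem h1).1, hc, by omega⟩, a.2, by rw [← h2]⟩
    · rintro (⟨h1, c, hc, k, rfl⟩ | ⟨l, hl, h1, c, hc, k, rfl⟩)
      · rw [Finset.mem_singleton] at hc
        subst hc
        exact ⟨h1, rfl, by simp [redHeight], by simp [IsTop]⟩
      · have hc' := (mem_verts.1 hc).2
        simp only [Finset.mem_filter, Finset.mem_univ, true_and] at hl
        refine ⟨h1, rfl, ?_, ?_⟩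
        · exact (redHeight_cons_le _ _).trans (by omega)
        · simp [IsTop, hc'.1, hl]
  rw [this, Finset.card_union_of_disjoint, Finset.card_biUnion, card_childrenOf,
    Finset.sum_singleton, hS.2]
  · intro l _ l' _ hll
    rw [Function.onFun, Finset.disjoint_left]
    intro e he he'
    obtain ⟨_, c, hc, k, rfl⟩ := mem_childrenOf.1 he
    obtain ⟨_, c', hc', k', h'⟩ := mem_childrenOf.1 he'
    simp only [List.cons.injEq] at h'
    have h1 := (mem_verts.1 hc).2.1
    rw [h'.2, (mem_verts.1 hc').2.1] at h1
    exact hll (Option.some.inj h1).symm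
  · rw [Finset.disjoint_left]
    intro e he he'
    obtain ⟨_, c, hc, k, rfl⟩ := mem_childrenOf.1 he
    obtain ⟨l, _, he'⟩ := Finset.mem_biUnion.1 he'
    obtain ⟨_, c', hc', k', h'⟩ := mem_childrenOf.1 he'
    rw [Finset.mem_singleton] at hc
    simp only [List.cons.injEq] at h'
    have h1 := (mem_verts.1 hc').2.1
    rw [← h'.2, hc] at h1
    simp at h1

theorem IsExplored.R_eq (hS : IsExplored r H S) (hx : Reads ξ H S) {h : ℕ} (hh : h ≤ H)
    (j : Fin d) : CodingWalk.R ξ r h j = (tops S h j).card := by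
  induction h generalizing j with
  | zero => rw [hS.tops_zero_card, CodingWalk.R]
  | succ h ih =>
    have hh' : h ≤ H := by omega
    rw [CodingWalk.R, hS.tops_succ_card]
    push_cast
    congr 1
    refine Finset.sum_congr rfl fun l hl => ?_
    rw [ih hh' l, hS.tau_tops hx hh', X_card_eq hx (isInitial_verts h l)
      (fun c hc => (mem_verts.1 hc).2.2.trans hh'), if_neg (by simpa using hl), sub_zero]

theorem IsExplored.U_eq (hS : IsExplored r H S) (hx : Reads ξ H S) {h : ℕ} (hh : h ≤ H)
    (j : Fin d) : CodingWalk.U ξ r h j = (verts S h j).card := by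
  rw [CodingWalk.U, hS.R_eq hx hh, hS.tau_tops hx hh]

/-- The explored set can be decoded from the walks. -/
theorem IsExplored.eq_of_reads {S' : Finset (Label d)} (hS : IsExplored r H S)
    (hS' : IsExplored r H S') (hx : Reads ξ H S) (hx' : Reads ξ H S') : S = S' := by
  classical
  by_contra hne
  -- the first vertex at which the numbers of children differ
  have hex : ((S ∩ S').filter fun c => redHeight c ≤ H ∧ childCount S c ≠ childCount S' c).Nonempty
      := by
    by_contra hemp
    rw [Finset.not_nonempty_iff_eq_empty, Finset.filter_eq_empty_iff] at hemp
    apply hne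
    have key : ∀ c, c ∈ S ↔ c ∈ S' := by
      intro c
      rw [← Finset.mem_coe, ← Finset.mem_coe, ← hS.1, ← hS'.1]
      induction c with
      | nil => simp
      | cons a c ih =>
        rw [cons_mem_tree, cons_mem_tree, ← ih]
        refine and_congr_right fun h1 => and_congr_right fun h2 => ?_
        have h3 := ih.1 h1
        rw [hS.1] at h1
        rw [hS'.1] at h3
        have := hemp (Finset.mem_inter.2 ⟨h1, h3⟩)
        rw [not_and, not_not] at this
        rw [this h2]
    exact Finset.ext key
  obtain ⟨c, hc, hmin⟩ := Finset.exists_min_image _ key hex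
  simp only [Finset.mem_filter, Finset.mem_inter] at hc hmin
  obtain ⟨⟨hcS, hcS'⟩, hcH, hcc⟩ := hc
  have hsame : ∀ e, key e < key c → (e ∈ S ↔ e ∈ S') := by
    intro e
    induction e with
    | nil => intro _; exact iff_of_true hS.nil_mem hS'.nil_mem
    | cons a e ih =>
      intro hlt
      have hlt' := (key_lt_cons a e).trans hlt
      have ih := ih hlt'
      rw [← Finset.mem_coe, ← Finset.mem_coe, ← hS.1, ← hS'.1, cons_mem_tree, cons_mem_tree,
        hS.1, hS'.1, Finset.mem_coe, Finset.mem_coe, ih]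
      refine and_congr_right fun h1 => and_congr_right fun h2 => ?_
      have : childCount S e = childCount S' e := by
        by_contra hce
        exact absurd (hmin e ⟨⟨ih.2 h1, h1⟩, h2, hce⟩) (not_le.2 hlt')
      rw [this]
  cases ht : type c with
  | none =>
    rw [type_eq_none_iff] at ht
    rw [ht, hS.2, hS'.2] at hcc
    exact hcc rfl
  | some i =>
    have hrank : rank S c = rank S' c := by
      rw [rank, rank]
      congr 1
      ext e
      simp only [Finset.mem_filter]
      constructor
      · rintro ⟨h1, h2, h3⟩; exact ⟨(hsame e h3).1 h1, h2, h3⟩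
      · rintro ⟨h1, h2, h3⟩; exact ⟨(hsame e h3).2 h1, h2, h3⟩
    exact hcc (by rw [← hx c hcS hcH i ht, ← hx' c hcS' hcH i ht, hrank])

end Label

/-! ### Extinction of (sub)critical branching processes -/

section SpectralRadius

open Filter

attribute [local instance] Matrix.linftyOpNormedRing Matrix.linftyOpNormedAlgebra

theorem Matrix.pow_apply_le_pow_apply_self {n : Type*} [Fintype n] [DecidableEq n]
    {A : Matrix n n ℝ} (hA : ∀ i j, 0 ≤ A i j) (i : n) (k : ℕ) :
    (∀ a b, 0 ≤ (A ^ k) a b) ∧ (A i i) ^ k ≤ (A ^ k) i i := by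
  induction k with
  | zero =>
    refine ⟨fun a b => ?_, by simp⟩
    rw [pow_zero, Matrix.one_apply]; split_ifs <;> norm_num
  | succ k ih =>
    constructor
    · intro a b
      rw [pow_succ, Matrix.mul_apply]
      exact Finset.sum_nonneg fun c _ => mul_nonneg (ih.1 a c) (hA c b)
    · rw [pow_succ, pow_succ, Matrix.mul_apply]
      exact (mul_le_mul_of_nonneg_right ih.2 (hA i i)).trans
        (Finset.single_le_sum (f := fun c => (A ^ k) i c * A c i)
          (fun c _ => mul_nonneg (ih.1 i c) (hA c i)) (Finset.mem_univ i))

/-- The diagonal entries of a nonnegative matrix are at most its spectral radius: the powers of the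
entry are at most the entries of the powers, and Gelfand's formula applies. -/
theorem Matrix.ofReal_diag_le_spectralRadius {n : Type*} [Fintype n] [DecidableEq n]
    {A : Matrix n n ℝ} (hA : ∀ i j, 0 ≤ A i j) (i : n) :
    ENNReal.ofReal (A i i) ≤ spectralRadius ℂ (A.map (fun a : ℝ => (a : ℂ))) := by
  have : CompleteSpace (Matrix n n ℂ) := FiniteDimensional.complete ℂ _
  refine ge_of_tendsto (spectrum.pow_nnnorm_pow_one_div_tendsto_nhds_spectralRadius
    (A.map (fun a : ℝ => (a : ℂ)))) ?_
  filter_upwards [eventually_gt_atTop 0] with k hk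
  have hpow : (A.map (fun a : ℝ => (a : ℂ))) ^ k = (A ^ k).map (fun a : ℝ => (a : ℂ)) :=
    (map_pow (Complex.ofRealHom.mapMatrix (m := n)) A k).symm
  have h1 : ((A i i) ^ k).toNNReal ≤ ‖(A.map (fun a : ℝ => (a : ℂ))) ^ k‖₊ := by
    rw [hpow, Matrix.linfty_opNNNorm_def]
    refine le_trans ?_ (Finset.le_sup (Finset.mem_univ i))
    refine le_trans ?_ (Finset.single_le_sum (fun _ _ => zero_le) (Finset.mem_univ i))
    rw [Real.toNNReal_le_iff_le_coe, Matrix.map_apply, coe_nnnorm, Complex.norm_real]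
    exact (Matrix.pow_apply_le_pow_apply_self hA i k).2.trans (le_abs_self _)
  have hk' : (k : ℝ) ≠ 0 := by positivity
  calc ENNReal.ofReal (A i i) = (ENNReal.ofReal (A i i) ^ (k : ℝ)) ^ (1 / k : ℝ) := by
        rw [← ENNReal.rpow_mul, mul_one_div_cancel hk', ENNReal.rpow_one]
    _ ≤ _ := by
        refine ENNReal.rpow_le_rpow ?_ (by positivity)
        rw [ENNReal.rpow_natCast, ← ENNReal.ofReal_pow (hA i i)]
        exact ENNReal.coe_le_coe.2 h1

end SpectralRadius

theorem IsSubcritical.integral_self_le_one {d : ℕ} {φ : Fin d → Measure (Fin d → ℕ)}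
    (hφ : IsSubcritical φ) (i : Fin d) : ∫ x, (x i : ℝ) ∂(φ i) ≤ 1 := by
  have h := (Matrix.ofReal_diag_le_spectralRadius (A := meanMatrix φ)
    (fun a b => integral_nonneg fun x => Nat.cast_nonneg _) i).trans hφ.spectralRadius_le
  rw [ENNReal.ofReal_le_one] at h
  exact h

theorem one_sub_mul_le_pow {s : ℝ} (h0 : 0 ≤ s) (h1 : s ≤ 1) (k : ℕ) :
    0 ≤ s ^ k - 1 + k * (1 - s) := by
  induction k with
  | zero => simp
  | succ k ih =>
    have : s ^ k ≤ 1 := pow_le_one₀ h0 h1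
    push_cast
    rw [pow_succ]
    nlinarith

theorem one_sub_mul_lt_pow {s : ℝ} (h0 : 0 ≤ s) (h1 : s < 1) {k : ℕ} (hk : 2 ≤ k) :
    0 < s ^ k - 1 + k * (1 - s) := by
  obtain ⟨m, rfl⟩ := Nat.exists_eq_add_of_le' (show 1 ≤ k by omega)
  have h2 := one_sub_mul_le_pow h0 h1.le m
  have : s ^ m < 1 := pow_lt_one₀ h0 h1 (by omega)
  push_cast
  rw [pow_succ]
  nlinarith

/-- A generating function with mean at most one, of a variable which is not almost surely one, has no
fixed point in `[0, 1)`: it is above its tangent at one, strictly where the variable exceeds one. -/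
theorem eq_one_of_integral_pow_eq {X : Type*} [MeasurableSpace X] {μ : Measure X}
    [IsProbabilityMeasure μ] {g : X → ℕ} (hg : Measurable g)
    (hint : Integrable (fun x => (g x : ℝ)) μ) (hmean : ∫ x, (g x : ℝ) ∂μ ≤ 1)
    (hnd : μ {x | g x = 1} < 1) {s : ℝ} (h0 : 0 ≤ s) (h1 : s ≤ 1)
    (hs : ∫ x, s ^ g x ∂μ = s) : s = 1 := by
  by_contra hne
  have hlt : s < 1 := lt_of_le_of_ne h1 hne
  have hpow : Integrable (fun x => s ^ g x) μ := by
    refine Integrable.of_bound (C := 1) (by fun_prop) (ae_of_all _ fun x => ?_)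
    rw [Real.norm_of_nonneg (by positivity)]
    exact pow_le_one₀ h0 h1
  have hI : Integrable (fun x => s ^ g x - 1 + g x * (1 - s)) μ :=
    (hpow.sub (integrable_const 1)).add (hint.mul_const _)
  have hval : ∫ x, (s ^ g x - 1 + g x * (1 - s)) ∂μ
      = s - 1 + (∫ x, (g x : ℝ) ∂μ) * (1 - s) := by
    rw [integral_add (f := fun x => s ^ g x - 1) (hpow.sub (integrable_const 1))
      (hint.mul_const _), integral_sub hpow (integrable_const 1), hs, integral_mul_const]
    simp
  have hnn : ∀ x, 0 ≤ s ^ g x - 1 + g x * (1 - s) := fun x => one_sub_mul_le_pow h0 h1 _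
  have hpos : 0 ≤ ∫ x, (s ^ g x - 1 + g x * (1 - s)) ∂μ := integral_nonneg hnn
  have hmean1 : ∫ x, (g x : ℝ) ∂μ = 1 := by
    rw [hval] at hpos
    nlinarith
  have hzero : ∫ x, (s ^ g x - 1 + g x * (1 - s)) ∂μ = 0 := by rw [hval, hmean1]; ring
  have hae := (integral_eq_zero_iff_of_nonneg hnn hI).1 hzero
  have hle : ∀ᵐ x ∂μ, g x ≤ 1 := by
    filter_upwards [hae] with x hx
    by_contra hgt
    exact absurd hx (one_sub_mul_lt_pow h0 hlt (by omega)).ne'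
  have hae1 : ∀ᵐ x ∂μ, (1 : ℝ) - g x = 0 := by
    have hnn' : 0 ≤ᵐ[μ] fun x => (1 : ℝ) - g x := by
      filter_upwards [hle] with x hx
      have : (g x : ℝ) ≤ 1 := by exact_mod_cast hx
      simpa using this
    refine (integral_eq_zero_iff_of_nonneg_ae hnn' ((integrable_const 1).sub hint)).1 ?_
    rw [integral_sub (integrable_const 1) hint, hmean1]
    simp
  have : μ {x | g x = 1} = 1 := by
    refine (prob_compl_eq_zero_iff (hg (measurableSet_singleton 1))).1 ?_
    refine measure_mono_null ?_ hae1
    intro x hx hx'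
    apply hx
    have : (g x : ℝ) = 1 := (sub_eq_zero.1 hx').symm
    exact_mod_cast this
  exact absurd this hnd.ne

/-- The extinction probabilities by generation `n` increase to one. -/
theorem iSup_eq_one_of_lintegral_pow {X : Type*} [MeasurableSpace X] {μ : Measure X}
    [IsProbabilityMeasure μ] {g : X → ℕ} (hg : Measurable g)
    (hint : Integrable (fun x => (g x : ℝ)) μ) (hmean : ∫ x, (g x : ℝ) ∂μ ≤ 1)
    (hnd : μ {x | g x = 1} < 1) {e : ℕ → ℝ≥0∞} (he0 : e 0 = 0)
    (he : ∀ n, e (n + 1) = ∫⁻ x, e n ^ g x ∂μ) : ⨆ n, e n = 1 := by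
  have hle : ∀ n, e n ≤ 1 := by
    intro n
    induction n with
    | zero => simp [he0]
    | succ n ih =>
      rw [he]
      calc ∫⁻ x, e n ^ g x ∂μ ≤ ∫⁻ _, 1 ∂μ := lintegral_mono fun x => pow_le_one₀ zero_le ih
        _ = 1 := by simp
  have hmono : Monotone e := by
    refine monotone_nat_of_le_succ fun n => ?_
    induction n with
    | zero => simp [he0]
    | succ n ih =>
      rw [he n, he (n + 1)]
      exact lintegral_mono fun x => pow_le_pow_left₀ zero_le ih _
  set t := ⨆ n, e n with ht
  have ht1 : t ≤ 1 := iSup_le hle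
  have hfix : ∫⁻ x, t ^ g x ∂μ = t := by
    have : ∀ x, t ^ g x = ⨆ n, e n ^ g x := fun x => ENNReal.iSup_pow _ _
    simp_rw [this]
    rw [lintegral_iSup (f := fun n x => e n ^ g x) (fun n => by fun_prop)
      (fun a b hab x => pow_le_pow_left₀ zero_le (hmono hab) _)]
    simp_rw [← he]
    apply le_antisymm
    · exact iSup_le fun n => le_iSup e (n + 1)
    · exact iSup_le fun n => (hmono n.le_succ).trans (le_iSup (fun n => e (n + 1)) n)
  have htop : t ≠ ⊤ := (ht1.trans_lt ENNReal.one_lt_top).ne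
  have hr : t.toReal = 1 := by
    refine eq_one_of_integral_pow_eq hg hint hmean hnd ENNReal.toReal_nonneg
      (ENNReal.toReal_le_of_le_ofReal zero_le_one (by simpa using ht1)) ?_
    rw [integral_eq_lintegral_of_nonneg_ae (ae_of_all _ fun x => by positivity) (by fun_prop)]
    congr 1
    rw [← hfix]
    refine lintegral_congr fun x => ?_
    rw [ENNReal.ofReal_pow ENNReal.toReal_nonneg, hfix, ENNReal.ofReal_toReal htop]
  rw [← ENNReal.ofReal_toReal htop, hr, ENNReal.ofReal_one]

/-! ### Independent child vectors -/

namespace Label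

variable {d : ℕ}

/-- The law of the child vector of a vertex. The virtual vertex has the roots as children. -/
noncomputable def offspringLaw (φ : Fin d → Measure (Fin d → ℕ)) (r : Fin d → ℕ) :
    Label d → Measure (Fin d → ℕ)
  | [] => Measure.dirac r
  | a :: _ => φ a.1

instance (φ : Fin d → Measure (Fin d → ℕ)) [∀ i, IsProbabilityMeasure (φ i)] (r : Fin d → ℕ)
    (c : Label d) : IsProbabilityMeasure (offspringLaw φ r c) := by
  cases c <;> (rw [offspringLaw]; infer_instance)

theorem offspringLaw_of_type {φ : Fin d → Measure (Fin d → ℕ)} {r : Fin d → ℕ} {c : Label d}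
    {i : Fin d} (h : type c = some i) : offspringLaw φ r c = φ i := by
  cases c with
  | nil => simp at h
  | cons a c => rw [type_cons, Option.some.injEq] at h; rw [offspringLaw, h]

open Classical in
/-- The probability of the child vectors prescribed by `S` at the vertices satisfying `p`. -/
noncomputable def weight (φ : Fin d → Measure (Fin d → ℕ)) (r : Fin d → ℕ) (p : Label d → Prop)
    (S : Finset (Label d)) : ℝ≥0∞ :=
  ∏ c ∈ S.filter p, offspringLaw φ r c {childCount S c}

theorem infinitePi_tree_eq (φ : Fin d → Measure (Fin d → ℕ)) [∀ i, IsProbabilityMeasure (φ i)]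
    (r : Fin d → ℕ) {p : Label d → Prop} {S : Finset (Label d)}
    (hS : tree p (childCount S) = S) :
    Measure.infinitePi (offspringLaw φ r) {ζ | tree p ζ = S} = weight φ r p S := by
  classical
  rw [weight, ← Measure.infinitePi_pi _ fun c _ => measurableSet_singleton _]
  congr 1
  ext ζ
  rw [Set.mem_ofPred_eq, tree_eq_iff, and_iff_right hS]
  simp [Set.mem_pi]

/-- Among the descendants of `c`, there is no line of descent of `n` vertices of type `i`: the type
`i` subtree below `c` has at most `n` generations, `c` included. -/
def MonoExtinct (i : Fin d) : ℕ → Label d → (Label d → Fin d → ℕ) → Prop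
  | 0, _, _ => False
  | n + 1, c, ζ => ∀ k < ζ c i, MonoExtinct i n ((i, k) :: c) ζ

/-- The event depends only on the child vectors of labels which are at least as long as `c`; this is
what makes it independent of the previous generations. -/
theorem measurableSet_monoExtinct (i : Fin d) (n : ℕ) {l : ℕ} {c : Label d} (hc : l ≤ c.length) :
    MeasurableSet[⨆ e ∈ {e : Label d | l ≤ e.length},
      MeasurableSpace.comap (fun ζ : Label d → Fin d → ℕ => ζ e) inferInstance]
      {ζ | MonoExtinct i n c ζ} := by
  induction n generalizing c with
  | zero => simp [MonoExtinct]
  | succ n ih =>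
    have : {ζ | MonoExtinct i (n + 1) c ζ}
        = ⋂ k : ℕ, ({ζ | ζ c i ≤ k} ∪ {ζ | MonoExtinct i n ((i, k) :: c) ζ}) := by
      ext ζ
      simp only [MonoExtinct, Set.mem_ofPred_eq, Set.mem_iInter, Set.mem_union]
      refine forall_congr' fun k => ?_
      rw [← not_lt, imp_iff_not_or]
    rw [this]
    refine MeasurableSet.iInter fun k => MeasurableSet.union ?_ (ih (by simp; omega))
    have h1 : MeasurableSet[MeasurableSpace.comap (fun ζ : Label d → Fin d → ℕ => ζ c)
        inferInstance] {ζ | ζ c i ≤ k} :=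
      ⟨{x | x i ≤ k}, (Set.to_countable _).measurableSet, rfl⟩
    exact le_iSup₂ (f := fun (e : Label d) (_ : e ∈ {e : Label d | l ≤ e.length}) =>
      MeasurableSpace.comap (fun ζ : Label d → Fin d → ℕ => ζ e) inferInstance) c hc _ h1

variable {φ : Fin d → Measure (Fin d → ℕ)} [∀ i, IsProbabilityMeasure (φ i)] {r : Fin d → ℕ}

theorem iIndepFun_eval : iIndepFun (fun (c : Label d) (ζ : Label d → Fin d → ℕ) => ζ c)
    (Measure.infinitePi (offspringLaw φ r)) :=
  iIndepFun_infinitePi (P := offspringLaw φ r) (X := fun _ x => x) fun _ => measurable_id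

/-- The type `i` subtrees of vertices of one generation are independent, and the probability that
they have at most `n` generations obeys the recursion of the generating function. -/
theorem infinitePi_biInter_monoExtinct (i : Fin d) {e : ℕ → ℝ≥0∞} (he0 : e 0 = 0)
    (he : ∀ n, e (n + 1) = ∫⁻ x, e n ^ x i ∂(φ i)) (n : ℕ) {l : ℕ} (A : Finset (Label d))
    (hA : ∀ c ∈ A, c.length = l ∧ type c = some i) :
    Measure.infinitePi (offspringLaw φ r) {ζ | ∀ c ∈ A, MonoExtinct i n c ζ} = e n ^ A.card := by
  classical
  induction n generalizing l A with
  | zero =>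
    rcases A.eq_empty_or_nonempty with rfl | ⟨c, hc⟩
    · simp
    · have : {ζ | ∀ c ∈ A, MonoExtinct i 0 c ζ} = ∅ := by
        ext ζ
        simp only [MonoExtinct, Set.mem_ofPred_eq, Set.mem_empty_iff_false, iff_false]
        exact fun h => h c hc
      rw [this, measure_empty, he0, zero_pow (Finset.card_ne_zero_of_mem hc)]
  | succ n ih =>
    set μ := Measure.infinitePi (offspringLaw φ r) with hμ
    let m : Label d → MeasurableSpace (Label d → Fin d → ℕ) := fun e =>
      MeasurableSpace.comap (fun ζ : Label d → Fin d → ℕ => ζ e) inferInstance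
    have hmle : ∀ e, m e ≤ (inferInstance : MeasurableSpace (Label d → Fin d → ℕ)) := fun e =>
      (measurable_pi_apply e).comap_le
    have hind : Indep (⨆ e ∈ {e : Label d | e.length = l}, m e)
        (⨆ e ∈ {e : Label d | l + 1 ≤ e.length}, m e) μ := by
      refine indep_iSup_of_disjoint hmle iIndepFun_eval.iIndep ?_
      rw [Set.disjoint_left]
      intro e h1 h2
      simp only [Set.mem_ofPred_eq] at h1 h2
      omega
    let ρ : (Label d → Fin d → ℕ) → (A → Fin d → ℕ) := fun ζ c => ζ c
    have hρ : Measurable ρ := by fun_prop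
    -- the children, given the child vectors `y` of the vertices in `A`
    let B : (A → Fin d → ℕ) → Finset (Label d) := fun y =>
      Finset.univ.biUnion fun c : A => (Finset.range (y c i)).image fun k => (i, k) :: (c : Label d)
    have hBmem : ∀ y e, e ∈ B y ↔ ∃ c : A, ∃ k < y c i, (i, k) :: (c : Label d) = e := by
      intro y e
      simp only [B, Finset.mem_biUnion, Finset.mem_univ, true_and, Finset.mem_image,
        Finset.mem_range]
    have hBcard : ∀ y, (B y).card = ∑ c : A, y c i := by
      intro y
      rw [Finset.card_biUnion]
      · refine Finset.sum_congr rfl fun c _ => ?_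
        rw [Finset.card_image_of_injective _ (fun a b hab => by simpa using hab),
          Finset.card_range]
      · intro c _ c' _ hcc
        rw [Function.onFun, Finset.disjoint_left]
        intro x hx hx'
        obtain ⟨k, _, rfl⟩ := Finset.mem_image.1 hx
        obtain ⟨k', _, h⟩ := Finset.mem_image.1 hx'
        simp only [List.cons.injEq] at h
        exact hcc (Subtype.ext h.2.symm)
    have hB : ∀ y, ∀ c ∈ B y, c.length = l + 1 ∧ type c = some i := by
      intro y c hc
      obtain ⟨c', k, _, rfl⟩ := (hBmem y c).1 hc
      exact ⟨by simp [(hA c' c'.2).1], rfl⟩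
    have hset : ∀ y, {ζ | ∀ c ∈ A, MonoExtinct i (n + 1) c ζ} ∩ ρ ⁻¹' {y}
        = ρ ⁻¹' {y} ∩ {ζ | ∀ c ∈ B y, MonoExtinct i n c ζ} := by
      intro y
      ext ζ
      simp only [Set.mem_inter_iff, Set.mem_ofPred_eq, Set.mem_preimage, Set.mem_singleton_iff]
      rw [and_comm]
      refine and_congr_right fun hy => ?_
      simp only [MonoExtinct, hBmem, ← hy, ρ]
      constructor
      · rintro h _ ⟨c, k, hk, rfl⟩
        exact h c c.2 k hk
      · intro h c hc k hk
        exact h _ ⟨⟨c, hc⟩, k, hk, rfl⟩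
    have hmeasB : ∀ y, MeasurableSet[⨆ e ∈ {e : Label d | l + 1 ≤ e.length}, m e]
        {ζ | ∀ c ∈ B y, MonoExtinct i n c ζ} := by
      intro y
      have : {ζ | ∀ c ∈ B y, MonoExtinct i n c ζ}
          = ⋂ c ∈ B y, {ζ | MonoExtinct i n c ζ} := by ext; simp
      rw [this]
      exact MeasurableSet.biInter (Finset.countable_toSet _) fun c hc =>
        measurableSet_monoExtinct i n (hB y c hc).1.ge
    have hmeasρ : ∀ y, MeasurableSet[⨆ e ∈ {e : Label d | e.length = l}, m e] (ρ ⁻¹' {y}) := by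
      intro y
      have : ρ ⁻¹' {y} = ⋂ c : A, {ζ | ζ c = y c} := by
        ext ζ
        simp [ρ, funext_iff]
      rw [this]
      refine MeasurableSet.iInter fun c => ?_
      have h1 : MeasurableSet[m c] {ζ | ζ c = y c} := ⟨{y c}, measurableSet_singleton _, rfl⟩
      exact le_iSup₂ (f := fun (e : Label d) (_ : e ∈ {e : Label d | e.length = l}) => m e)
        (c : Label d) (hA c c.2).1 _ h1
    have hval : ∀ y, μ ({ζ | ∀ c ∈ A, MonoExtinct i (n + 1) c ζ} ∩ ρ ⁻¹' {y})
        = e n ^ (∑ c : A, y c i) * μ (ρ ⁻¹' {y}) := by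
      intro y
      rw [hset, (Indep_iff _ _ _).1 hind _ _ (hmeasρ y) (hmeasB y), ih (B y) (hB y), hBcard,
        mul_comm]
    have hsum : μ {ζ | ∀ c ∈ A, MonoExtinct i (n + 1) c ζ}
        = ∑' y, μ ({ζ | ∀ c ∈ A, MonoExtinct i (n + 1) c ζ} ∩ ρ ⁻¹' {y}) := by
      rw [← measure_iUnion]
      · congr 1
        ext ζ
        simp
      · intro y y' hyy
        rw [Function.onFun, Set.disjoint_left]
        rintro ζ ⟨_, h1⟩ ⟨_, h2⟩
        simp only [Set.mem_preimage, Set.mem_singleton_iff] at h1 h2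
        exact hyy (h1.symm.trans h2)
      · intro y
        rw [hset]
        exact (hρ (measurableSet_singleton y)).inter (iSup₂_le (fun e _ => hmle e) _ (hmeasB y))
    have hmap : ∀ c ∈ A, ∫⁻ ζ, e n ^ ζ c i ∂μ = e (n + 1) := by
      intro c hc
      rw [he, ← offspringLaw_of_type (φ := φ) (r := r) (hA c hc).2,
        ← Measure.infinitePi_map_eval (offspringLaw φ r) c, lintegral_map (by fun_prop) (by fun_prop)]
    have hindX : iIndepFun (fun (c : Label d) (ζ : Label d → Fin d → ℕ) => e n ^ ζ c i) μ :=
      iIndepFun_eval.comp (fun _ x => e n ^ x i) fun _ => by fun_prop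
    rw [hsum]
    simp_rw [hval]
    calc ∑' y, e n ^ (∑ c : A, y c i) * μ (ρ ⁻¹' {y})
        = ∫⁻ y, e n ^ (∑ c : A, y c i) ∂(μ.map ρ) := by
          rw [lintegral_countable']
          refine tsum_congr fun y => ?_
          rw [Measure.map_apply hρ (measurableSet_singleton y)]
      _ = ∫⁻ ζ, ∏ c ∈ A, e n ^ ζ c i ∂μ := by
          rw [lintegral_map (by fun_prop) hρ]
          refine lintegral_congr fun ζ => ?_
          rw [Finset.prod_pow_eq_pow_sum, ← Finset.sum_coe_sort A fun c => ζ c i]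
      _ = ∏ c ∈ A, ∫⁻ ζ, e n ^ ζ c i ∂μ :=
          lintegral_prod_eq_prod_lintegral_of_indepFun A _ hindX fun c => by fun_prop
      _ = e (n + 1) ^ A.card := by
          rw [Finset.prod_congr rfl hmap, Finset.prod_const]

theorem ae_exists_monoExtinct (hφ : IsSubcritical φ) :
    ∀ᵐ ζ ∂(Measure.infinitePi (offspringLaw φ r)), ∀ (c : Label d) (i : Fin d),
      type c = some i → ∃ n, MonoExtinct i n c ζ := by
  rw [ae_all_iff]
  refine fun c => ae_all_iff.2 fun i => ?_
  by_cases hc : type c = some i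
  swap
  · exact ae_of_all _ fun _ h => absurd h hc
  let e : ℕ → ℝ≥0∞ := fun n => Nat.rec 0 (fun _ s => ∫⁻ x, s ^ x i ∂(φ i)) n
  have hsup : ⨆ n, e n = 1 := iSup_eq_one_of_lintegral_pow (measurable_pi_apply i)
    (hφ.integrable i i) (hφ.integral_self_le_one i) (hφ.nondegenerate i) rfl fun _ => rfl
  have hle : ∀ n, e n ≤ Measure.infinitePi (offspringLaw φ r) {ζ | ∃ n, MonoExtinct i n c ζ} := by
    intro n
    have := infinitePi_biInter_monoExtinct (φ := φ) (r := r) i (e := e) rfl (fun _ => rfl) n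
      (l := c.length) {c} (by simp [hc])
    rw [Finset.card_singleton, pow_one] at this
    rw [← this]
    exact measure_mono fun ζ h => ⟨n, h c (Finset.mem_singleton_self c)⟩
  have hm : MeasurableSet {ζ | ∃ n, MonoExtinct i n c ζ} := by
    rw [Set.ofPred_exists]
    exact MeasurableSet.iUnion fun n => iSup₂_le (fun e _ => (measurable_pi_apply e).comap_le) _
      (measurableSet_monoExtinct i n le_rfl)
  filter_upwards [(mem_ae_iff_prob_eq_one hm).2 (le_antisymm prob_le_one
    (hsup ▸ iSup_le hle))] with ζ hζ _ using hζ

end Label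

/-! ### Finiteness of the truncations and the law of the walks -/

namespace Label

variable {d : ℕ}

theorem mem_tree_of_append {p : Label d → Prop} {ζ : Label d → Fin d → ℕ} {l c : Label d}
    (h : l ++ c ∈ tree p ζ) : c ∈ tree p ζ := by
  induction l with
  | nil => exact h
  | cons a l ih => exact ih h.1

theorem finite_mono_descendants {p : Label d → Prop} {ζ : Label d → Fin d → ℕ} {i : Fin d} {n : ℕ}
    {c : Label d} (h : MonoExtinct i n c ζ) :
    {e ∈ tree p ζ | ∃ l : Label d, (∀ a ∈ l, a.1 = i) ∧ e = l ++ c}.Finite := by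
  induction n generalizing c with
  | zero => exact h.elim
  | succ n ih =>
    have hfin : (⋃ k ∈ Set.Iio (ζ c i), {e ∈ tree p ζ | ∃ l : Label d, (∀ a ∈ l, a.1 = i) ∧
        e = l ++ ((i, k) :: c)}).Finite :=
      Set.Finite.biUnion (Set.finite_Iio _) fun k hk => ih (h k hk)
    refine (hfin.insert c).subset ?_
    rintro e ⟨he, l, hl, rfl⟩
    rcases List.eq_nil_or_concat l with rfl | ⟨l', a, rfl⟩
    · left; rfl
    · right
      obtain ⟨j, k⟩ := a
      have hj : j = i := hl (j, k) (by simp)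
      subst hj
      rw [List.concat_eq_append, List.append_assoc] at he ⊢
      have hk : k < ζ c j := (mem_tree_of_append he).2.2
      simp only [Set.mem_iUnion]
      exact ⟨k, hk, he, l', fun a ha => hl a (by simp [ha]), rfl⟩

/-- Every vertex is joined to the first vertex of its typed subtree by vertices of its type. -/
theorem exists_top_of_mem_tree (c : Label d) (hc : c ≠ []) :
    ∃ i l e, (∀ a ∈ l, a.1 = i) ∧ c = l ++ e ∧ type e = some i ∧ IsTop e ∧
      redHeight e = redHeight c ∧ type c = some i := by
  induction c with
  | nil => exact absurd rfl hc
  | cons a c ih =>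
    by_cases ht : type c = some a.1
    · have hc' : c ≠ [] := by rintro rfl; simp at ht
      obtain ⟨i, l, e, h1, rfl, h2, h3, h4, h5⟩ := ih hc'
      have hi : i = a.1 := Option.some.inj (h5.symm.trans ht)
      refine ⟨i, a :: l, e, ?_, rfl, h2, h3, ?_, by rw [type_cons, hi]⟩
      · intro b hb
        rcases List.mem_cons.1 hb with rfl | hb
        · exact hi.symm
        · exact h1 b hb
      · rw [h4]; exact (redHeight_cons_of_type_eq ht).symm
    · exact ⟨a.1, [], a :: c, by simp, rfl, rfl, ht, rfl, rfl⟩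

theorem finite_children {p : Label d → Prop} {ζ : Label d → Fin d → ℕ} {V : Set (Label d)}
    (hV : V.Finite) : {e ∈ tree p ζ | ∃ a, ∃ c ∈ V, e = a :: c}.Finite := by
  have : (⋃ c ∈ V, ⋃ j : Fin d, (fun k => (j, k) :: c) '' Set.Iio (ζ c j)).Finite :=
    hV.biUnion fun c _ => Set.finite_iUnion fun j => (Set.finite_Iio _).image _
  refine this.subset ?_
  rintro e ⟨he, a, c, hc, rfl⟩
  simp only [Set.mem_iUnion]
  exact ⟨c, hc, a.1, a.2, he.2.2, rfl⟩

theorem finite_tree_redHeight_le {p : Label d → Prop} {ζ : Label d → Fin d → ℕ}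
    (h : ∀ (c : Label d) (i : Fin d), type c = some i → ∃ n, MonoExtinct i n c ζ) (m : ℕ) :
    {c ∈ tree p ζ | redHeight c ≤ m}.Finite := by
  have hdesc : ∀ m, {c ∈ tree p ζ | redHeight c ≤ m ∧ IsTop c}.Finite →
      {c ∈ tree p ζ | redHeight c ≤ m}.Finite := by
    intro m hm
    have : (⋃ c ∈ {c ∈ tree p ζ | redHeight c ≤ m ∧ IsTop c}, ⋃ i : Fin d,
        {e ∈ tree p ζ | type c = some i ∧ ∃ l : Label d, (∀ a ∈ l, a.1 = i) ∧
          e = l ++ c}).Finite := by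
      refine hm.biUnion fun c _ => Set.finite_iUnion fun i => ?_
      by_cases hc : type c = some i
      · obtain ⟨n, hn⟩ := h c i hc
        exact (finite_mono_descendants hn).subset fun e he => ⟨he.1, he.2.2⟩
      · convert Set.finite_empty
        ext e
        simp [hc]
    refine (this.insert []).subset ?_
    rintro e ⟨he, hem⟩
    rcases eq_or_ne e [] with rfl | hne
    · left; rfl
    · right
      obtain ⟨i, l, c, h1, rfl, h2, h3, h4, -⟩ := exists_top_of_mem_tree e hne
      simp only [Set.mem_iUnion]
      exact ⟨c, ⟨mem_tree_of_append he, h4.trans_le hem, h3⟩, i, he, h2, l, h1, rfl⟩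
  induction m with
  | zero =>
    refine hdesc 0 ((finite_children (p := p) (ζ := ζ) (V := {[]})
      (Set.finite_singleton _)).subset ?_)
    rintro e ⟨he, h0, ht⟩
    refine ⟨he, ?_⟩
    cases e with
    | nil => exact ht.elim
    | cons a c =>
      refine ⟨a, c, ?_, rfl⟩
      cases hc : type c with
      | none => exact type_eq_none_iff.1 hc
      | some i =>
        have : i ≠ a.1 := by rintro rfl; exact ht hc
        rw [redHeight_cons_of_ne hc this] at h0
        omega
  | succ m ih =>
    refine hdesc (m + 1) ((finite_children (p := p) (ζ := ζ) ih).subset ?_)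
    rintro e ⟨he, hm, ht⟩
    refine ⟨he, ?_⟩
    cases e with
    | nil => exact ht.elim
    | cons a c =>
      refine ⟨a, c, ⟨he.1, ?_⟩, rfl⟩
      cases hc : type c with
      | none => rw [type_eq_none_iff.1 hc]; simp [redHeight]
      | some i =>
        have : i ≠ a.1 := by rintro rfl; exact ht hc
        rw [redHeight_cons_of_ne hc this] at hm
        omega

theorem finite_tree {ζ : Label d → Fin d → ℕ}
    (h : ∀ (c : Label d) (i : Fin d), type c = some i → ∃ n, MonoExtinct i n c ζ) (H : ℕ) :
    (tree (fun c => redHeight c ≤ H) ζ).Finite := by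
  refine (finite_tree_redHeight_le h (H + 1)).subset fun c hc => ⟨hc, ?_⟩
  cases c with
  | nil => simp [redHeight]
  | cons a c => exact (redHeight_cons_le a c).trans (by have := hc.2.1; omega)

theorem measurableSet_tree_eq (p : Label d → Prop) (S : Finset (Label d)) :
    MeasurableSet {ζ : Label d → Fin d → ℕ | tree p ζ = S} := by
  by_cases hS : tree p (childCount S) = S
  · have : {ζ : Label d → Fin d → ℕ | tree p ζ = S}
        = ⋂ c : Label d, {ζ | c ∈ S → p c → ζ c = childCount S c} := by
      ext ζ
      rw [Set.mem_ofPred_eq, tree_eq_iff, and_iff_right hS]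
      simp
    rw [this]
    refine MeasurableSet.iInter fun c => ?_
    by_cases hc : c ∈ S ∧ p c
    · simp only [hc.1, hc.2, forall_true_left]
      exact measurableSet_eq_fun (measurable_pi_apply c) measurable_const
    · convert MeasurableSet.univ
      ext ζ
      simp only [Set.mem_ofPred_eq, Set.mem_univ, iff_true]
      exact fun h1 h2 => absurd ⟨h1, h2⟩ hc
  · convert MeasurableSet.empty
    ext ζ
    simp only [Set.mem_ofPred_eq, Set.mem_empty_iff_false, iff_false]
    exact fun h => hS (tree_eq_iff.1 h).1

variable {φ : Fin d → Measure (Fin d → ℕ)}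

/-- The truncations at reduced height `H` are almost surely finite. -/
theorem tsum_weight_eq_one [∀ i, IsProbabilityMeasure (φ i)] (hφ : IsSubcritical φ)
    (r : Fin d → ℕ) (H : ℕ) :
    ∑' S : {S : Finset (Label d) // IsExplored r H S},
      weight φ r (fun c => redHeight c ≤ H) S = 1 := by
  have h1 : ∀ S : {S : Finset (Label d) // IsExplored r H S},
      weight φ r (fun c => redHeight c ≤ H) S = Measure.infinitePi (offspringLaw φ r)
        {ζ | tree (fun c => redHeight c ≤ H) ζ = (S : Finset (Label d))} := fun S =>
    (infinitePi_tree_eq φ r S.2.1).symm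
  simp_rw [h1]
  rw [← measure_iUnion]
  · rw [← mem_ae_iff_prob_eq_one (MeasurableSet.iUnion fun S => measurableSet_tree_eq _ _)]
    have hroot : ∀ᵐ ζ ∂(Measure.infinitePi (offspringLaw φ r)), ζ [] = r := by
      have : ∀ᵐ x ∂((Measure.infinitePi (offspringLaw φ r)).map fun ζ => ζ []), x = r := by
        rw [Measure.infinitePi_map_eval, offspringLaw, ae_dirac_eq]
        rfl
      exact ae_of_ae_map (measurable_pi_apply _).aemeasurable this
    filter_upwards [hroot, ae_exists_monoExtinct hφ] with ζ h2 h3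
    have hf := finite_tree h3 H
    rw [Set.mem_iUnion]
    have hS : tree (fun c => redHeight c ≤ H) ζ = (hf.toFinset : Set (Label d)) := by simp
    refine ⟨⟨hf.toFinset, (tree_eq_iff.1 hS).1, ?_⟩, hS⟩
    rw [childCount_eq hS (by simp) (by simp [redHeight]), h2]
  · intro S S' hne
    rw [Function.onFun, Set.disjoint_left]
    intro ζ h h'
    exact hne (Subtype.ext (Finset.coe_injective (h.symm.trans h')))
  · exact fun S => measurableSet_tree_eq _ _

section Walk

variable {r : Fin d → ℕ} {Ω' : Type*} [MeasurableSpace Ω'] {Q : Measure Ω'}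
  {ξ : Fin d → ℕ → Ω' → Fin d → ℕ}

theorem measurableSet_reads (hξ : ∀ i k, Measurable (ξ i k)) (H : ℕ) (S : Finset (Label d)) :
    MeasurableSet {ω | Reads (fun i k => ξ i k ω) H S} := by
  have : {ω | Reads (fun i k => ξ i k ω) H S} = ⋂ c ∈ S, ⋂ (_ : redHeight c ≤ H),
      ⋂ i : Fin d, ⋂ (_ : type c = some i), ξ i (rank S c) ⁻¹' {childCount S c} := by
    ext ω
    simp [Reads]
  rw [this]
  exact MeasurableSet.biInter (Finset.countable_toSet _) fun c _ => MeasurableSet.iInter fun _ =>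
    MeasurableSet.iInter fun i => MeasurableSet.iInter fun _ =>
      hξ i _ (measurableSet_singleton _)

/-- The vertices of `S` use distinct steps of the walks, so their child vectors are independent. -/
theorem measure_reads (hξ_meas : ∀ i k, Measurable (ξ i k)) (hξ_law : ∀ i k, Q.map (ξ i k) = φ i)
    (hξ_indep : iIndepFun (fun p : Fin d × ℕ => ξ p.1 p.2) Q) {H : ℕ} {S : Finset (Label d)}
    (hS : IsExplored r H S) :
    Q {ω | Reads (fun i k => ξ i k ω) H S} = weight φ r (fun c => redHeight c ≤ H) S := by
  classical
  let T : Finset (Label d) := S.filter fun c => redHeight c ≤ H ∧ (type c).isSome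
  have hT : ∀ c : T, (type (c : Label d)).isSome := fun c => (Finset.mem_filter.1 c.2).2.2
  let g : T → Fin d × ℕ := fun c => ((type (c : Label d)).get (hT c), rank S c)
  have hg : Function.Injective g := by
    intro c e h
    simp only [g, Prod.mk.injEq] at h
    refine Subtype.ext (rank_inj (Finset.mem_filter.1 c.2).1 (Finset.mem_filter.1 e.2).1 ?_ h.2)
    exact Option.get_inj.1 h.1
  have h1 := (hξ_indep.precomp hg).meas_iInter
    (s := fun c : T => ξ (g c).1 (g c).2 ⁻¹' {childCount S c})
    fun c => ⟨_, measurableSet_singleton _, rfl⟩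
  have h2 : {ω | Reads (fun i k => ξ i k ω) H S}
      = ⋂ c : T, ξ (g c).1 (g c).2 ⁻¹' {childCount S c} := by
    ext ω
    simp only [Reads, Set.mem_ofPred_eq, Set.mem_iInter, Set.mem_preimage, Set.mem_singleton_iff]
    constructor
    · intro h c
      have hc := Finset.mem_filter.1 c.2
      exact h c hc.1 hc.2.1 _ (Option.some_get (hT c)).symm
    · intro h c hc hH i hi
      have := h ⟨c, Finset.mem_filter.2 ⟨hc, hH, by simp [hi]⟩⟩
      simpa [g, hi] using this
  rw [h2, h1, weight]
  have h3 : ∀ c : T, Q (ξ (g c).1 (g c).2 ⁻¹' {childCount S c})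
      = offspringLaw φ r c {childCount S c} := by
    intro c
    rw [← Measure.map_apply (hξ_meas _ _) (measurableSet_singleton _), hξ_law,
      offspringLaw_of_type (Option.some_get (hT c)).symm]
  simp_rw [h3]
  rw [Finset.prod_coe_sort T fun c => offspringLaw φ r c {childCount S c}]
  refine Finset.prod_subset ?_ ?_
  · intro c hc
    have hc := Finset.mem_filter.1 hc
    simp only [Finset.mem_filter]
    exact ⟨hc.1, hc.2.1⟩
  · intro c hc hcT
    simp only [Finset.mem_filter] at hc
    have : type c = none := by
      by_contra hne
      exact hcT (Finset.mem_filter.2 ⟨hc.1, hc.2, Option.isSome_iff_ne_none.2 hne⟩)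
    -- the virtual vertex uses no step of the walks, and its factor is one
    rw [type_eq_none_iff] at this
    rw [this, offspringLaw, hS.2]
    simp

theorem ae_exists_reads [∀ i, IsProbabilityMeasure (φ i)] [IsProbabilityMeasure Q]
    (hφ : IsSubcritical φ)
    (hξ_meas : ∀ i k, Measurable (ξ i k)) (hξ_law : ∀ i k, Q.map (ξ i k) = φ i)
    (hξ_indep : iIndepFun (fun p : Fin d × ℕ => ξ p.1 p.2) Q) (r : Fin d → ℕ) (H : ℕ) :
    ∀ᵐ ω ∂Q, ∃ S : {S : Finset (Label d) // IsExplored r H S}, Reads (fun i k => ξ i k ω) H S := by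
  have hm : MeasurableSet (⋃ S : {S : Finset (Label d) // IsExplored r H S},
      {ω | Reads (fun i k => ξ i k ω) H (S : Finset (Label d))}) :=
    MeasurableSet.iUnion fun S => measurableSet_reads hξ_meas H S
  have h1 : Q (⋃ S : {S : Finset (Label d) // IsExplored r H S},
      {ω | Reads (fun i k => ξ i k ω) H (S : Finset (Label d))}) = 1 := by
    refine (measure_iUnion ?_ fun S : {S : Finset (Label d) // IsExplored r H S} =>
      measurableSet_reads hξ_meas H S).trans ?_
    rotate_left
    · rw [← tsum_weight_eq_one hφ r H]
      exact tsum_congr fun S => measure_reads hξ_meas hξ_law hξ_indep S.2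
    · intro S S' hne
      rw [Function.onFun, Set.disjoint_left]
      intro ω h h'
      exact hne (Subtype.ext (IsExplored.eq_of_reads (ξ := fun i k => ξ i k ω) S.2 S'.2 h h'))
  filter_upwards [(mem_ae_iff_prob_eq_one hm).2 h1] with ω hω
  exact Set.mem_iUnion.1 hω

/-- With `m` roots of each type, `X^{i,i}` reaches `-m` when the typed subtrees of the roots of type
`i` are explored. -/
theorem ae_exists_hitting [∀ i, IsProbabilityMeasure (φ i)] [IsProbabilityMeasure Q]
    (hφ : IsSubcritical φ)
    (hξ_meas : ∀ i k, Measurable (ξ i k)) (hξ_law : ∀ i k, Q.map (ξ i k) = φ i)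
    (hξ_indep : iIndepFun (fun p : Fin d × ℕ => ξ p.1 p.2) Q) :
    ∀ᵐ ω ∂Q, ∀ (i : Fin d) (m : ℕ),
      ∃ k : ℕ, CodingWalk.X (fun i k => ξ i k ω) i i k = -(m : ℤ) := by
  rw [ae_all_iff]
  refine fun i => ae_all_iff.2 fun m => ?_
  filter_upwards [ae_exists_reads hφ hξ_meas hξ_law hξ_indep (fun _ => m) 0] with ω ⟨S, hS⟩
  refine ⟨_, (S.2.X_card_verts hS le_rfl i).trans ?_⟩
  rw [S.2.tops_zero_card]

end Walk

end Label

/-! ### Labels of the vertices of a plane forest -/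

section ListNth

variable {α : Type*} [DecidableEq α]

theorem List.card_getElem?_eq_some (l : List α) (a : α)
    (hf : (Set.ofPred fun i : ℕ => l[i]? = some a).Finite) : hf.toFinset.card = l.count a := by
  have h1 : hf.toFinset = (Finset.range l.length).filter fun i => l[i]? = some a := by
    ext i
    simp only [Set.Finite.mem_toFinset, Set.mem_ofPred_eq, Finset.mem_filter, Finset.mem_range]
    refine ⟨fun h => ⟨?_, h⟩, fun h => h.2⟩
    by_contra hi
    rw [List.getElem?_eq_none (not_lt.1 hi)] at h
    simp at h
  rw [h1, ← Nat.count_eq_card_filter_range]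
  clear h1 hf
  induction l with
  | nil => simp
  | cons b l ih =>
    rw [List.length_cons, Nat.count_succ']
    simp only [List.getElem?_cons_succ, List.getElem?_cons_zero, ih, List.count_cons,
      Option.some.injEq, beq_iff_eq]

theorem List.finite_getElem?_eq_some {α : Type*} (l : List α) (a : α) :
    (Set.ofPred fun i : ℕ => l[i]? = some a).Finite := by
  refine (Set.finite_Iio l.length).subset fun i h => ?_
  by_contra hi
  rw [Set.mem_ofPred_eq, List.getElem?_eq_none (not_lt.1 hi)] at h
  simp at h

theorem List.getElem?_nth {l : List α} {a : α} {k : ℕ} (hk : k < l.count a) :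
    l[Nat.nth (fun i => l[i]? = some a) k]? = some a :=
  Nat.nth_mem (p := fun i => l[i]? = some a) k
    fun hf => by rw [List.card_getElem?_eq_some]; exact hk

theorem List.nth_getElem?_inj {l : List α} {a : α} {k k' : ℕ} (hk : k < l.count a)
    (hk' : k' < l.count a)
    (h : Nat.nth (fun i => l[i]? = some a) k = Nat.nth (fun i => l[i]? = some a) k') : k = k' := by
  refine Nat.nth_injOn (l.finite_getElem?_eq_some a) ?_ ?_ h <;>
  rw [List.card_getElem?_eq_some] <;> assumption

theorem List.exists_nth_getElem? {l : List α} {a : α} {i : ℕ} (hi : l[i]? = some a) :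
    ∃ k < l.count a, Nat.nth (fun i => l[i]? = some a) k = i := by
  refine ⟨Nat.count (fun i => l[i]? = some a) i, ?_, Nat.nth_count hi⟩
  rw [← List.card_getElem?_eq_some l a (l.finite_getElem?_eq_some a)]
  exact Nat.count_lt_card _ hi

end ListNth

namespace MForest

open Label

variable {d : ℕ} (F : MForest d)

/-- The types of the children of a vertex, the roots being the children of the virtual vertex `[]`. -/
def siblings : List ℕ → List (Fin d)
  | [] => F.rootTypes
  | k :: v => F.childTypes (k :: v)

theorem siblings_of_ne_nil {v : List ℕ} (h : v ≠ []) : F.siblings v = F.childTypes v := by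
  cases v with
  | nil => exact absurd rfl h
  | cons => rfl

/-- The Ulam-Harris label of the vertex with the given label. The value is junk for labels which are
not in the forest. -/
noncomputable def decode : Label d → List ℕ
  | [] => []
  | a :: c => Nat.nth (fun i => (F.siblings (decode c))[i]? = some a.1) a.2 :: decode c

/-- The child vectors of the forest, indexed by `Label`. -/
noncomputable def offspring (c : Label d) : Fin d → ℕ := fun j => (F.siblings (F.decode c)).count j

/-- The labels of the vertices of the forest, and the virtual vertex. -/
noncomputable def labels : Set (Label d) := tree (fun _ => True) F.offspring

variable {F}

theorem cons_mem_labels {a : Fin d × ℕ} {c : Label d} :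
    a :: c ∈ F.labels ↔ c ∈ F.labels ∧ a.2 < (F.siblings (F.decode c)).count a.1 := by
  rw [labels, cons_mem_tree, true_and]; rfl

theorem length_decode (c : Label d) : (F.decode c).length = c.length := by
  induction c with
  | nil => rfl
  | cons a c ih => rw [decode, List.length_cons, List.length_cons, ih]

theorem decode_ne_nil {c : Label d} (h : c ≠ []) : F.decode c ≠ [] := by
  rw [← List.length_pos_iff, length_decode, List.length_pos_iff]; exact h

theorem HasType.ne_nil {v : List ℕ} {i : Fin d} (h : F.HasType v i) : v ≠ [] := by
  cases h <;> simp

theorem hasType_decode {a : Fin d × ℕ} {c : Label d} (h : a :: c ∈ F.labels) :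
    F.HasType (F.decode (a :: c)) a.1 := by
  induction c generalizing a with
  | nil =>
    rw [cons_mem_labels] at h
    exact HasType.root _ _ (List.getElem?_nth h.2)
  | cons b c ih =>
    rw [cons_mem_labels] at h
    refine HasType.child _ b.1 _ _ (ih h.1) ?_
    rw [← F.siblings_of_ne_nil (decode_ne_nil (by simp))]
    exact List.getElem?_nth h.2

theorem decode_injOn : Set.InjOn F.decode F.labels := by
  intro c hc e he h
  induction c generalizing e with
  | nil =>
    have := congrArg List.length h
    rw [length_decode, length_decode] at this
    exact (List.length_eq_zero_iff.1 this.symm).symm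
  | cons a c ih =>
    cases e with
    | nil =>
      have := congrArg List.length h
      rw [length_decode, length_decode] at this
      simp at this
    | cons b e =>
      rw [decode, decode, List.cons.injEq] at h
      have hce : c = e := ih (cons_mem_labels.1 hc).1 (cons_mem_labels.1 he).1 h.2
      subst hce
      have h1 := (cons_mem_labels.1 hc).2
      have h2 := (cons_mem_labels.1 he).2
      have h3 := List.getElem?_nth h1
      have h4 := List.getElem?_nth h2
      rw [h.1, h4, Option.some.injEq] at h3
      obtain ⟨j, k⟩ := a
      obtain ⟨j', k'⟩ := b
      dsimp only at *
      subst h3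
      rw [List.nth_getElem?_inj h1 h2 h.1]

theorem HasType.exists_label {v : List ℕ} {i : Fin d} (h : F.HasType v i) :
    ∃ c ∈ F.labels, F.decode c = v ∧ type c = some i := by
  induction h with
  | root k i hk =>
    obtain ⟨m, hm, hmk⟩ := List.exists_nth_getElem? hk
    exact ⟨[(i, m)], cons_mem_labels.2 ⟨nil_mem_tree, hm⟩, by
      rw [decode]; exact congrArg (· :: []) hmk, rfl⟩
  | child v i k j hv hk ih =>
    obtain ⟨c, hc, rfl, hci⟩ := ih
    rw [← F.siblings_of_ne_nil hv.ne_nil] at hk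
    obtain ⟨m, hm, hmk⟩ := List.exists_nth_getElem? hk
    exact ⟨(j, m) :: c, cons_mem_labels.2 ⟨hc, hm⟩,
      by rw [decode]; exact congrArg (· :: F.decode c) hmk, rfl⟩

/-- The label of a vertex. -/
noncomputable def Vertex.code (v : F.Vertex) : Label d := v.2.exists_label.choose

theorem Vertex.code_mem (v : F.Vertex) : v.code ∈ F.labels := v.2.exists_label.choose_spec.1

theorem Vertex.decode_code (v : F.Vertex) : F.decode v.code = v.label :=
  v.2.exists_label.choose_spec.2.1

theorem Vertex.type_code (v : F.Vertex) : Label.type v.code = some v.type :=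
  v.2.exists_label.choose_spec.2.2

theorem Vertex.length_code (v : F.Vertex) : v.code.length = v.label.length := by
  rw [← length_decode (F := F), v.decode_code]

theorem Vertex.code_injective : Function.Injective (Vertex.code (F := F)) := by
  intro u v h
  apply Subtype.ext
  apply Prod.ext
  · show u.label = v.label
    rw [← u.decode_code, ← v.decode_code, h]
  · show u.type = v.type
    rw [← Option.some_inj, ← u.type_code, ← v.type_code, h]

theorem exists_code_eq {c : Label d} (hc : c ∈ F.labels) (hne : c ≠ []) :
    ∃ v : F.Vertex, v.code = c := by
  cases c with
  | nil => exact absurd rfl hne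
  | cons a c =>
    let v : F.Vertex := ⟨(F.decode (a :: c), a.1), hasType_decode hc⟩
    exact ⟨v, decode_injOn v.code_mem hc v.decode_code⟩

theorem isParent_iff {u v : F.Vertex} :
    u.IsParent v ↔ ∃ k, v.code = (v.type, k) :: u.code := by
  constructor
  · rintro ⟨m, hm⟩
    have hv := v.decode_code
    have hmem := v.code_mem
    have ht := v.type_code
    cases hc : v.code with
    | nil => rw [hc, hm, decode] at hv; exact absurd hv (by simp)
    | cons a c =>
      rw [hc] at hv hmem ht
      rw [hm, decode, List.cons.injEq] at hv
      have : c = u.code := decode_injOn (cons_mem_labels.1 hmem).1 u.code_mem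
        (hv.2.trans u.decode_code.symm)
      rw [type_cons, Option.some_inj] at ht
      exact ⟨a.2, by rw [this, ← ht]⟩
  · rintro ⟨k, hk⟩
    have hv := v.decode_code
    rw [hk, decode, u.decode_code] at hv
    exact ⟨_, hv.symm⟩

end MForest

/-! ### The reduced forest in terms of labels -/

namespace Label

variable {d : ℕ}

open Classical in
/-- The first vertex of the typed subtree. -/
noncomputable def topOf : Label d → Label d
  | [] => []
  | a :: c => if type c = some a.1 then topOf c else a :: c

theorem topOf_cons_of_type_eq {a : Fin d × ℕ} {c : Label d} (h : type c = some a.1) :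
    topOf (a :: c) = topOf c := by
  rw [topOf, if_pos h]

theorem topOf_eq_self {c : Label d} (h : IsTop c) : topOf c = c := by
  cases c with
  | nil => exact h.elim
  | cons a c => exact if_neg h

theorem topOf_spec {c : Label d} (hc : c ≠ []) :
    IsTop (topOf c) ∧ type (topOf c) = type c ∧ redHeight (topOf c) = redHeight c := by
  induction c with
  | nil => exact absurd rfl hc
  | cons a c ih =>
    by_cases h : type c = some a.1
    · have hne : c ≠ [] := by rintro rfl; simp at h
      rw [topOf_cons_of_type_eq h, redHeight_cons_of_type_eq h, type_cons, ← h]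
      exact ih hne
    · rw [topOf, if_neg h]
      exact ⟨h, rfl, rfl⟩

theorem mem_tree_of_redHeight_le {ζ : Label d → Fin d → ℕ} {H : ℕ} {c : Label d}
    (hc : c ∈ tree (fun _ => True) ζ) (h : redHeight c ≤ H) :
    c ∈ tree (fun c => redHeight c ≤ H) ζ := by
  induction c with
  | nil => simp
  | cons a c ih =>
    have h' := (redHeight_le_cons a c).trans h
    exact ⟨ih hc.1 h', h', hc.2.2⟩

end Label

namespace MForest

open Label

variable {d : ℕ} {F : MForest d}

theorem Vertex.code_ne_nil (v : F.Vertex) : v.code ≠ [] := by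
  intro h
  have := v.type_code
  rw [h] at this
  simp at this

theorem Vertex.IsParent.code_spec {u v : F.Vertex} (h : u.IsParent v) :
    (u.type = v.type → topOf v.code = topOf u.code ∧ redHeight v.code = redHeight u.code) ∧
    redHeight u.code ≤ redHeight v.code ∧ redHeight v.code ≤ redHeight u.code + 1 := by
  obtain ⟨k, hk⟩ := isParent_iff.1 h
  rw [hk]
  refine ⟨fun ht => ?_, redHeight_le_cons _ _, redHeight_cons_le _ _⟩
  have h1 : Label.type u.code = some v.type := by rw [u.type_code, ht]
  exact ⟨topOf_cons_of_type_eq h1, redHeight_cons_of_type_eq h1⟩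

theorem Vertex.IsParent.ne {u v : F.Vertex} (h : u.IsParent v) : u ≠ v := by
  rintro rfl
  obtain ⟨k, hk⟩ := isParent_iff.1 h
  exact absurd (congrArg List.length hk) (by simp)

theorem walk_code_eq {u v : F.Vertex} (p : F.monoGraph.Walk u v) :
    topOf u.code = topOf v.code ∧ redHeight u.code = redHeight v.code := by
  induction p with
  | nil => exact ⟨rfl, rfl⟩
  | cons h _ ih =>
    rcases h.2 with h | h
    · have := h.1.code_spec.1 h.2
      exact ⟨this.1.symm.trans ih.1, this.2.symm.trans ih.2⟩
    · have := h.1.code_spec.1 h.2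
      exact ⟨this.1.trans ih.1, this.2.trans ih.2⟩

/-- The label of the first vertex of a typed subtree. -/
noncomputable def Subtree.topLabel (C : F.Subtree) : Label d :=
  SimpleGraph.ConnectedComponent.lift (fun v : F.Vertex => topOf v.code)
    (fun _ _ p _ => (walk_code_eq p).1) C

theorem topLabel_subtree (v : F.Vertex) : v.subtree.topLabel = topOf v.code := rfl

theorem type_subtree (v : F.Vertex) : v.subtree.type = v.type := rfl

theorem Subtree.exists_vertex (C : F.Subtree) : ∃ v : F.Vertex, v.subtree = C :=
  Quot.exists_rep C

theorem redHeight_topLabel_subtree (v : F.Vertex) :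
    redHeight v.subtree.topLabel = redHeight v.code :=
  (topOf_spec v.code_ne_nil).2.2

theorem subtree_eq_of_isParent {u v : F.Vertex} (h : u.IsParent v) (ht : u.type = v.type) :
    u.subtree = v.subtree := by
  refine SimpleGraph.ConnectedComponent.sound (SimpleGraph.Adj.reachable ?_)
  rw [monoGraph, SimpleGraph.fromRel_adj]
  exact ⟨h.ne, Or.inl ⟨h, ht⟩⟩

theorem Vertex.isRoot_or_exists_parent (v : F.Vertex) : v.IsRoot ∨ ∃ u : F.Vertex, u.IsParent v := by
  have hmem := v.code_mem
  have ht := v.type_code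
  cases hc : v.code with
  | nil => exact absurd hc v.code_ne_nil
  | cons a c =>
    rcases eq_or_ne c [] with rfl | hne
    · left
      rw [Vertex.IsRoot, ← v.length_code, hc]; rfl
    · right
      rw [hc] at hmem ht
      obtain ⟨u, hu⟩ := exists_code_eq (cons_mem_labels.1 hmem).1 hne
      rw [type_cons, Option.some_inj] at ht
      exact ⟨u, isParent_iff.2 ⟨a.2, by rw [hc, hu, ← ht]⟩⟩

theorem Vertex.IsRoot.redHeight_code {v : F.Vertex} (h : v.IsRoot) : redHeight v.code = 0 := by
  rw [Vertex.IsRoot, ← v.length_code, List.length_eq_one_iff] at h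
  obtain ⟨a, ha⟩ := h
  rw [ha]; simp [redHeight]

theorem exists_subtree_eq_of_code_eq_topOf (v : F.Vertex) :
    ∃ u : F.Vertex, u.code = topOf v.code ∧ u.subtree = v.subtree := by
  induction hn : v.code.length generalizing v with
  | zero => exact absurd (List.length_eq_zero_iff.1 hn) v.code_ne_nil
  | succ n ih =>
    by_cases htop : Label.IsTop v.code
    · exact ⟨v, (topOf_eq_self htop).symm, rfl⟩
    · rcases v.isRoot_or_exists_parent with h | ⟨u, hu⟩
      · rw [Vertex.IsRoot, ← v.length_code, List.length_eq_one_iff] at h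
        obtain ⟨a, ha⟩ := h
        rw [ha] at htop
        exact absurd (by simp [Label.IsTop]) htop
      · obtain ⟨k, hk⟩ := isParent_iff.1 hu
        have ht : u.type = v.type := by
          rw [hk] at htop
          simpa [Label.IsTop, u.type_code] using htop
        obtain ⟨w, hw1, hw2⟩ := ih u (by rw [hk] at hn; simpa using hn)
        exact ⟨w, hw1.trans (hu.code_spec.1 ht).1.symm, hw2.trans (subtree_eq_of_isParent hu ht)⟩

theorem topLabel_injective : Function.Injective (Subtree.topLabel (F := F)) := by
  intro C D h
  obtain ⟨v, rfl⟩ := C.exists_vertex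
  obtain ⟨w, rfl⟩ := D.exists_vertex
  rw [topLabel_subtree, topLabel_subtree] at h
  obtain ⟨v', hv1, hv2⟩ := exists_subtree_eq_of_code_eq_topOf v
  obtain ⟨w', hw1, hw2⟩ := exists_subtree_eq_of_code_eq_topOf w
  rw [← hv2, ← hw2, Vertex.code_injective (hv1.trans (h.trans hw1.symm))]

/-- The reduced height changes by at most one along an edge of the reduced forest. -/
theorem walk_reducedGraph_redHeight_le {C D : F.Subtree} (p : F.reducedGraph.Walk C D) :
    redHeight D.topLabel ≤ redHeight C.topLabel + p.length := by
  induction p with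
  | nil => simp
  | cons h q ih =>
    rw [SimpleGraph.Walk.length_cons]
    have key : ∀ {A B : F.Subtree}, (∃ u v : F.Vertex, u.subtree = A ∧ v.subtree = B ∧ u.IsParent v) →
        redHeight A.topLabel ≤ redHeight B.topLabel ∧
        redHeight B.topLabel ≤ redHeight A.topLabel + 1 := by
      rintro _ _ ⟨u, v, rfl, rfl, huv⟩
      rw [redHeight_topLabel_subtree, redHeight_topLabel_subtree]
      exact huv.code_spec.2
    rcases h.2 with h | h
    · have := (key h).2; omega
    · have := (key h).1; omega

theorem exists_root_edist_le (v : F.Vertex) :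
    ∃ ρ : F.Subtree, ρ.IsRoot ∧ F.reducedGraph.edist ρ v.subtree ≤ redHeight v.code := by
  induction hn : v.code.length generalizing v with
  | zero => exact absurd (List.length_eq_zero_iff.1 hn) v.code_ne_nil
  | succ n ih =>
    rcases v.isRoot_or_exists_parent with h | ⟨u, hu⟩
    · exact ⟨v.subtree, ⟨v, h, rfl⟩, by rw [SimpleGraph.edist_self]; exact zero_le⟩
    · obtain ⟨k, hk⟩ := isParent_iff.1 hu
      obtain ⟨ρ, hρ, hle⟩ := ih u (by rw [hk] at hn; simpa using hn)
      refine ⟨ρ, hρ, ?_⟩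
      by_cases ht : u.type = v.type
      · rw [← subtree_eq_of_isParent hu ht, (hu.code_spec.1 ht).2]
        exact hle
      · have hadj : F.reducedGraph.Adj u.subtree v.subtree := by
          rw [reducedGraph, SimpleGraph.fromRel_adj]
          refine ⟨fun h => ht ?_, Or.inl ⟨u, v, rfl, rfl, hu⟩⟩
          rw [← type_subtree, ← type_subtree, h]
        have h1 : redHeight v.code = redHeight u.code + 1 := by
          rw [hk]; exact redHeight_cons_of_ne u.type_code ht
        calc F.reducedGraph.edist ρ v.subtree
            ≤ F.reducedGraph.edist ρ u.subtree + F.reducedGraph.edist u.subtree v.subtree :=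
              SimpleGraph.edist_triangle
          _ ≤ redHeight u.code + 1 := by
              gcongr
              exact (SimpleGraph.edist_eq_one_iff_adj.2 hadj).le
          _ = redHeight v.code := by rw [h1]; push_cast; rfl

theorem height_subtree (v : F.Vertex) : v.subtree.height = redHeight v.code := by
  apply le_antisymm
  · obtain ⟨ρ, hρ, hle⟩ := exists_root_edist_le v
    exact (iInf₂_le ρ hρ).trans hle
  · refine le_iInf₂ fun ρ hρ => ?_
    obtain ⟨u, hu, rfl⟩ := hρ
    rw [SimpleGraph.edist]
    refine le_iInf fun p => ?_
    have := walk_reducedGraph_redHeight_le p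
    rw [redHeight_topLabel_subtree, redHeight_topLabel_subtree, hu.redHeight_code, zero_add] at this
    exact_mod_cast this

theorem image_code_verticesUpTo (h : ℕ) (j : Fin d) :
    Vertex.code '' F.verticesUpTo h j
      = {c ∈ F.labels | Label.type c = some j ∧ redHeight c ≤ h} := by
  ext c
  constructor
  · rintro ⟨v, ⟨h1, h2⟩, rfl⟩
    rw [Vertex.reducedHeight, height_subtree] at h2
    exact ⟨v.code_mem, by rw [v.type_code, h1], by exact_mod_cast h2⟩
  · rintro ⟨h1, h2, h3⟩
    obtain ⟨v, rfl⟩ := exists_code_eq h1 (by rintro rfl; simp at h2)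
    refine ⟨v, ⟨?_, ?_⟩, rfl⟩
    · rw [v.type_code, Option.some_inj] at h2; exact h2
    · rw [Vertex.reducedHeight, height_subtree]; exact_mod_cast h3

theorem image_topLabel_reducedUpTo (h : ℕ) (j : Fin d) :
    Subtree.topLabel '' F.reducedUpTo h j
      = {c ∈ F.labels | Label.type c = some j ∧ redHeight c ≤ h ∧ Label.IsTop c} := by
  ext c
  constructor
  · rintro ⟨C, ⟨h1, h2⟩, rfl⟩
    obtain ⟨v, rfl⟩ := C.exists_vertex
    rw [height_subtree] at h2
    rw [type_subtree] at h1
    have hs := topOf_spec v.code_ne_nil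
    obtain ⟨u, hu, -⟩ := exists_subtree_eq_of_code_eq_topOf v
    rw [topLabel_subtree]
    refine ⟨hu ▸ u.code_mem, by rw [hs.2.1, v.type_code, h1], ?_, hs.1⟩
    rw [hs.2.2]
    exact_mod_cast h2
  · rintro ⟨h1, h2, h3, h4⟩
    obtain ⟨v, rfl⟩ := exists_code_eq h1 (by rintro rfl; simp at h2)
    refine ⟨v.subtree, ⟨?_, ?_⟩, topOf_eq_self h4⟩
    · rw [v.type_code, Option.some_inj] at h2; exact h2
    · rw [height_subtree]; exact_mod_cast h3

variable {S : Finset (Label d)} {H : ℕ}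

theorem mem_labels_iff_of_tree_eq (hS : tree (fun c => redHeight c ≤ H) F.offspring = S) {h : ℕ}
    (hh : h ≤ H) {c : Label d} (hc : redHeight c ≤ h) : c ∈ F.labels ↔ c ∈ S := by
  rw [← Finset.mem_coe, ← hS]
  exact ⟨fun h1 => mem_tree_of_redHeight_le h1 (hc.trans hh), fun h1 => tree_mono (by simp) h1⟩

theorem verticesUpTo_of_tree_eq (hS : tree (fun c => redHeight c ≤ H) F.offspring = S) {h : ℕ}
    (hh : h ≤ H) (j : Fin d) :
    (F.verticesUpTo h j).Finite ∧ (F.verticesUpTo h j).ncard = (verts S h j).card := by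
  have : Vertex.code '' F.verticesUpTo h j = verts S h j := by
    rw [image_code_verticesUpTo]
    ext c
    rw [Finset.mem_coe, mem_verts]
    constructor
    · rintro ⟨h1, h2, h3⟩; exact ⟨(mem_labels_iff_of_tree_eq hS hh h3).1 h1, h2, h3⟩
    · rintro ⟨h1, h2, h3⟩; exact ⟨(mem_labels_iff_of_tree_eq hS hh h3).2 h1, h2, h3⟩
  constructor
  · refine Set.Finite.of_finite_image ?_ Vertex.code_injective.injOn
    rw [this]; exact Finset.finite_toSet _
  · rw [← Set.ncard_image_of_injective _ Vertex.code_injective, this, Set.ncard_coe_finset]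

theorem reducedUpTo_of_tree_eq (hS : tree (fun c => redHeight c ≤ H) F.offspring = S) {h : ℕ}
    (hh : h ≤ H) (j : Fin d) :
    (F.reducedUpTo h j).Finite ∧ (F.reducedUpTo h j).ncard = (tops S h j).card := by
  have : Subtree.topLabel '' F.reducedUpTo h j = tops S h j := by
    rw [image_topLabel_reducedUpTo]
    ext c
    rw [Finset.mem_coe, mem_tops]
    constructor
    · rintro ⟨h1, h2, h3, h4⟩; exact ⟨(mem_labels_iff_of_tree_eq hS hh h3).1 h1, h2, h3, h4⟩
    · rintro ⟨h1, h2, h3, h4⟩; exact ⟨(mem_labels_iff_of_tree_eq hS hh h3).2 h1, h2, h3, h4⟩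
  constructor
  · refine Set.Finite.of_finite_image ?_ topLabel_injective.injOn
    rw [this]; exact Finset.finite_toSet _
  · rw [← Set.ncard_image_of_injective _ topLabel_injective, this, Set.ncard_coe_finset]

end MForest

/-! ### The law of the forest -/

section CountablePartition

variable {Ω ι : Type*} [MeasurableSpace Ω] [Countable ι] {g : Ω → ι}

theorem measure_eq_tsum_preimage_inter (P : Measure Ω) (hg : ∀ i, MeasurableSet (g ⁻¹' {i}))
    (A : Set Ω) : P A = ∑' i, P (g ⁻¹' {i} ∩ A) := by
  have h1 : ∀ i, P (g ⁻¹' {i} ∩ A) = P.restrict A (g ⁻¹' {i}) := fun i =>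
    (Measure.restrict_apply (hg i)).symm
  simp_rw [h1]
  rw [← measure_iUnion _ hg]
  · rw [← Measure.restrict_apply_univ A]
    congr 1
    ext ω
    simp
  · intro i j hij
    rw [Function.onFun, Set.disjoint_left]
    intro ω hi hj
    exact hij (hi.symm.trans hj)

theorem measurableSet_of_determined (hg : ∀ i, MeasurableSet (g ⁻¹' {i})) {A : Set Ω}
    (hA : ∀ ω ω', g ω = g ω' → ω ∈ A → ω' ∈ A) : MeasurableSet A := by
  have : A = ⋃ i ∈ g '' A, g ⁻¹' {i} := by
    ext ω
    simp only [Set.mem_iUnion, Set.mem_image]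
    constructor
    · intro h; exact ⟨g ω, ⟨ω, h, rfl⟩, rfl⟩
    · rintro ⟨i, ⟨ω', h, rfl⟩, h'⟩
      exact hA ω' ω h'.symm h
  rw [this]
  exact MeasurableSet.biUnion (Set.to_countable _) fun i _ => hg i

end CountablePartition

namespace Label

variable {d : ℕ} {ζ ζ' : Label d → Fin d → ℕ}

theorem mem_tree_length_lt_iff {n : ℕ} {c : Label d} :
    c ∈ tree (fun c => c.length < n) ζ ↔ c ∈ tree (fun _ => True) ζ ∧ c.length ≤ n := by
  induction c with
  | nil => simp
  | cons a c ih =>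
    rw [cons_mem_tree, cons_mem_tree, ih, List.length_cons]
    constructor
    · rintro ⟨⟨h1, h2⟩, h3, h4⟩; exact ⟨⟨h1, trivial, h4⟩, h3⟩
    · rintro ⟨⟨h1, -, h4⟩, h3⟩; exact ⟨⟨h1, by omega⟩, by omega, h4⟩

theorem finite_tree_length_le (p : Label d → Prop) (ζ : Label d → Fin d → ℕ) (n : ℕ) :
    {c ∈ tree p ζ | c.length ≤ n}.Finite := by
  induction n with
  | zero =>
    refine (Set.finite_singleton []).subset ?_
    rintro c ⟨-, hc⟩
    exact List.length_eq_zero_iff.1 (Nat.le_zero.1 hc)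
  | succ n ih =>
    refine ((finite_children ih (p := p) (ζ := ζ)).insert []).subset ?_
    rintro c ⟨hc, hn⟩
    cases c with
    | nil => left; rfl
    | cons a c => exact Or.inr ⟨hc, a, c, ⟨hc.1, by simpa using hn⟩, rfl⟩

/-- The vertices of the first generations, as a finite set. -/
noncomputable def truncate (ζ : Label d → Fin d → ℕ) (n : ℕ) : Finset (Label d) :=
  (finite_tree_length_le (fun _ => True) ζ n).toFinset

theorem coe_truncate (ζ : Label d → Fin d → ℕ) (n : ℕ) :
    (truncate ζ n : Set (Label d)) = tree (fun c => c.length < n) ζ := by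
  ext c
  rw [mem_tree_length_lt_iff, truncate, Set.Finite.coe_toFinset]
  rfl

theorem truncate_eq_iff {n : ℕ} {W : Finset (Label d)} :
    truncate ζ n = W ↔ tree (fun c => c.length < n) ζ = W := by
  rw [← coe_truncate, Finset.coe_inj]

/-- The first generations decide whether the tree is a given set of short labels. -/
theorem tree_childCount_truncate {p : Label d → Prop} {n : ℕ} {S : Finset (Label d)}
    (hS : ∀ c ∈ S, c.length < n) :
    tree p (childCount (truncate ζ n)) = S ↔ tree p ζ = S := by
  have h0 := (coe_truncate ζ n).symm
  have h1 : ∀ c ∈ tree (fun c => c.length < n) ζ, c.length < n →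
      ζ c = childCount (truncate ζ n) c := fun c hc hn =>
    (childCount_eq h0 (by rw [h0] at hc; exact hc) hn).symm
  have h2 : tree (fun c => c.length < n) ζ
      = tree (fun c => c.length < n) (childCount (truncate ζ n)) := tree_congr h1
  have h3 : ∀ {η : Label d → Fin d → ℕ} {c : Label d}, tree p η = S → c ∈ tree p η →
      c.length < n ∧ c ∈ tree (fun c => c.length < n) η := by
    intro η c h hc
    have hn : c.length < n := hS c (by rw [h] at hc; exact hc)
    exact ⟨hn, mem_tree_length_lt_iff.2 ⟨tree_mono (by simp) hc, hn.le⟩⟩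
  constructor
  · intro h
    rw [← h]
    refine (tree_congr fun c hc _ => ?_).symm
    have := h3 h hc
    exact (h1 c (h2 ▸ this.2) this.1).symm
  · intro h
    rw [← h]
    refine (tree_congr fun c hc _ => ?_).symm
    have := h3 h hc
    exact h1 c this.2 this.1

/-- The vertices of the tree with labels of length less than `n`. -/
noncomputable def lowerLabels (x : Label d → Fin d → ℕ) (n : ℕ) : Finset (Label d) :=
  (truncate x n).filter fun c => c.length < n

theorem mem_lowerLabels {x : Label d → Fin d → ℕ} {n : ℕ} {c : Label d} :
    c ∈ lowerLabels x n ↔ c ∈ tree (fun _ => True) x ∧ c.length < n := by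
  rw [lowerLabels, Finset.mem_filter, ← Finset.mem_coe, coe_truncate, mem_tree_length_lt_iff]
  constructor
  · rintro ⟨⟨h1, _⟩, h2⟩; exact ⟨h1, h2⟩
  · rintro ⟨h1, h2⟩; exact ⟨⟨h1, h2.le⟩, h2⟩

/-- The vertices of the tree with labels of length `n`. -/
noncomputable def level (x : Label d → Fin d → ℕ) (n : ℕ) : Finset (Label d) :=
  (truncate x n).filter fun c => c.length = n

theorem mem_level {x : Label d → Fin d → ℕ} {n : ℕ} {c : Label d} :
    c ∈ level x n ↔ c ∈ tree (fun _ => True) x ∧ c.length = n := by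
  rw [level, Finset.mem_filter, ← Finset.mem_coe, coe_truncate, mem_tree_length_lt_iff]
  constructor
  · rintro ⟨⟨h1, _⟩, h2⟩; exact ⟨h1, h2⟩
  · rintro ⟨h1, h2⟩; exact ⟨⟨h1, h2.le⟩, h2⟩

theorem mem_lowerLabels_succ {x : Label d → Fin d → ℕ} {n : ℕ} {c : Label d} :
    c ∈ lowerLabels x (n + 1) ↔ c ∈ lowerLabels x n ∨ c ∈ level x n := by
  rw [mem_lowerLabels, mem_lowerLabels, mem_level, ← and_or_left, Nat.lt_succ_iff_lt_or_eq]

theorem prod_lowerLabels_succ {M : Type*} [CommMonoid M] (x : Label d → Fin d → ℕ) (n : ℕ)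
    (f : Label d → M) :
    ∏ c ∈ lowerLabels x (n + 1), f c = (∏ c ∈ lowerLabels x n, f c) * ∏ c ∈ level x n, f c := by
  classical
  rw [← Finset.prod_union]
  · congr 1
    ext c
    rw [Finset.mem_union, mem_lowerLabels_succ]
  · rw [Finset.disjoint_left]
    intro c h1 h2
    exact absurd (mem_lowerLabels.1 h1).2 (by rw [(mem_level.1 h2).2]; exact lt_irrefl _)

end Label

namespace MForest

open Label

variable {d : ℕ} {F t : MForest d}

theorem hasType_cons_iff {k : ℕ} {v : List ℕ} {j : Fin d} :
    F.HasType (k :: v) j ↔ (v = [] ∨ ∃ i, F.HasType v i) ∧ (F.siblings v)[k]? = some j := by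
  constructor
  · intro h
    cases h with
    | root _ _ h => exact ⟨Or.inl rfl, h⟩
    | child _ i _ _ h1 h2 =>
      exact ⟨Or.inr ⟨i, h1⟩, by rw [F.siblings_of_ne_nil h1.ne_nil]; exact h2⟩
  · rintro ⟨rfl | ⟨i, h1⟩, h2⟩
    · exact HasType.root _ _ h2
    · rw [F.siblings_of_ne_nil h1.ne_nil] at h2
      exact HasType.child _ _ _ _ h1 h2

/-- The typed Ulam-Harris labels of the first generations, which describe a forest up to that
generation by a countable amount of information. -/
noncomputable def pattern (F : MForest d) (n : ℕ) : Set (List ℕ × Fin d) :=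
  {p | F.HasType p.1 p.2 ∧ p.1.length ≤ n}

theorem finite_pattern (F : MForest d) (n : ℕ) : (F.pattern n).Finite := by
  have : (⋃ i : Fin d, (fun c => (F.decode c, i)) '' {c ∈ F.labels | c.length ≤ n}).Finite :=
    Set.finite_iUnion fun i => (finite_tree_length_le _ _ n).image _
  refine this.subset ?_
  rintro ⟨v, i⟩ ⟨h1, h2⟩
  obtain ⟨c, hc, rfl, _⟩ := h1.exists_label
  exact Set.mem_iUnion.2 ⟨i, c, ⟨hc, by rw [length_decode] at h2; exact h2⟩, rfl⟩

theorem agreeUpTo_iff_pattern_eq (n : ℕ) :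
    F.AgreeUpTo t n ↔ F.pattern (n + 1) = t.pattern (n + 1) := by
  constructor
  · rintro ⟨h1, h2⟩
    have key : ∀ v : List ℕ, v.length ≤ n + 1 → ∀ i, F.HasType v i ↔ t.HasType v i := by
      intro v
      induction v with
      | nil => intro _ i; exact iff_of_false (fun h => h.ne_nil rfl) (fun h => h.ne_nil rfl)
      | cons k v ih =>
        intro hv j
        rw [List.length_cons] at hv
        have ih' := ih (by omega)
        rw [hasType_cons_iff, hasType_cons_iff]
        simp only [ih']
        refine and_congr_right fun h => ?_
        have : F.siblings v = t.siblings v := by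
          rcases h with rfl | ⟨i, hi⟩
          · exact h1
          · rw [F.siblings_of_ne_nil hi.ne_nil, t.siblings_of_ne_nil hi.ne_nil]
            exact h2 ⟨(v, i), hi⟩ (by show v.length ≤ n; omega)
        rw [this]
    ext ⟨v, i⟩
    exact and_congr_left fun hv => key v hv i
  · intro h
    have key : ∀ v i, v.length ≤ n + 1 → (F.HasType v i ↔ t.HasType v i) := by
      intro v i hv
      have := Set.ext_iff.1 h (v, i)
      exact (and_iff_left hv).symm.trans (this.trans (and_iff_left hv))
    have key2 : ∀ v, v.length ≤ n → (v = [] ∨ ∃ i, t.HasType v i) → F.siblings v = t.siblings v := by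
      intro v hv ht
      refine List.ext_getElem? fun k => Option.ext fun j => ?_
      have h1 := key (k :: v) j (by simpa using hv)
      rw [hasType_cons_iff, hasType_cons_iff, and_iff_right ht, and_iff_right] at h1
      · exact h1
      · exact ht.imp_right fun ⟨i, hi⟩ => ⟨i, (key v i (by omega)).2 hi⟩
    refine ⟨key2 [] (Nat.zero_le _) (Or.inl rfl), fun v hv => ?_⟩
    have hne : v.label ≠ [] := HasType.ne_nil v.2
    rw [← F.siblings_of_ne_nil hne, ← t.siblings_of_ne_nil hne]
    exact key2 v.label hv (Or.inr ⟨v.type, v.2⟩)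

theorem AgreeUpTo.decode_eq {n : ℕ} (h : F.AgreeUpTo t n) {c : Label d} (hc : c ∈ t.labels)
    (hn : c.length ≤ n + 1) : F.decode c = t.decode c ∧
      (c.length ≤ n → F.siblings (F.decode c) = t.siblings (t.decode c)) := by
  induction c with
  | nil => exact ⟨rfl, fun _ => h.1⟩
  | cons a c ih =>
    rw [List.length_cons] at hn
    obtain ⟨h1, h2⟩ := ih hc.1 (by omega)
    have h3 : F.decode (a :: c) = t.decode (a :: c) := by
      rw [decode, decode, h2 (by omega), h1]
    refine ⟨h3, fun hn' => ?_⟩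
    have hne : t.decode (a :: c) ≠ [] := decode_ne_nil (by simp)
    rw [h3, F.siblings_of_ne_nil hne, t.siblings_of_ne_nil hne]
    exact h.2 ⟨(t.decode (a :: c), a.1), hasType_decode hc⟩ (by
      show (t.decode (a :: c)).length ≤ n
      rw [length_decode]; exact hn')

theorem AgreeUpTo.offspring_eq {n : ℕ} (h : F.AgreeUpTo t n) {c : Label d} (hc : c ∈ t.labels)
    (hn : c.length ≤ n) : F.offspring c = t.offspring c := by
  funext j
  rw [offspring, offspring, (h.decode_eq hc (by omega)).2 hn]

theorem AgreeUpTo.offspring_eq_childVector {n : ℕ} (h : F.AgreeUpTo t n) (v : t.Vertex)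
    (hv : v.label.length = n + 1) : F.offspring v.code = F.childVector v.label := by
  funext j
  rw [offspring, (h.decode_eq v.code_mem (by rw [v.length_code, hv])).1, v.decode_code,
    F.siblings_of_ne_nil (v := v.label) (HasType.ne_nil v.2), childVector]

end MForest

namespace IsMBGWForest

open Label MForest

variable {d : ℕ} {Ω : Type*} [MeasurableSpace Ω] {P : Measure Ω}
  {φ : Fin d → Measure (Fin d → ℕ)} {r : Fin d → ℕ} {F : Ω → MForest d}

theorem measurableSet_pattern_eq (hF : IsMBGWForest P φ r F) (n : ℕ)
    (T : Finset (List ℕ × Fin d)) :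
    MeasurableSet ((fun ω => ((F ω).finite_pattern n).toFinset) ⁻¹' {T}) := by
  have : (fun ω => ((F ω).finite_pattern n).toFinset) ⁻¹' {T}
      = ⋂ p : List ℕ × Fin d, {ω | p ∈ (F ω).pattern n ↔ p ∈ T} := by
    ext ω
    simp only [Set.mem_preimage, Set.mem_singleton_iff, Set.mem_iInter, Finset.ext_iff,
      Set.Finite.mem_toFinset, Set.mem_ofPred_eq]
  rw [this]
  refine MeasurableSet.iInter fun p => ?_
  have h1 : MeasurableSet {ω | p ∈ (F ω).pattern n} := by
    by_cases hp : p.1.length ≤ n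
    · simpa [pattern, hp] using hF.measurable p.1 p.2
    · simp [pattern, hp]
  by_cases hp : p ∈ T
  · simpa [hp] using h1
  · simp only [hp, iff_false]
    exact h1.compl

/-- An event which is determined by the forest up to some generation is measurable. -/
theorem measurableSet_of_pattern (hF : IsMBGWForest P φ r F) (n : ℕ) {A : Set Ω}
    (hA : ∀ ω ω', (F ω).AgreeUpTo (F ω') n → ω ∈ A → ω' ∈ A) : MeasurableSet A := by
  refine measurableSet_of_determined (hF.measurableSet_pattern_eq (n + 1)) fun ω ω' h => hA ω ω' ?_
  rw [agreeUpTo_iff_pattern_eq]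
  exact Set.Finite.toFinset_inj.1 h

/-- The branching property for the child vectors indexed by labels, obtained by decomposing according
to the planar forest up to generation `n`. -/
theorem measure_branching (hF : IsMBGWForest P φ r F) (x : Label d → Fin d → ℕ) (n : ℕ) :
    P {ω | ∀ c ∈ lowerLabels x (n + 2), (F ω).offspring c = x c}
      = P {ω | ∀ c ∈ lowerLabels x (n + 1), (F ω).offspring c = x c} *
        ∏ c ∈ level x (n + 1), offspringLaw φ r c {x c} := by
  rw [measure_eq_tsum_preimage_inter P (hF.measurableSet_pattern_eq (n + 1)),
    measure_eq_tsum_preimage_inter P (hF.measurableSet_pattern_eq (n + 1))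
      {ω | ∀ c ∈ lowerLabels x (n + 1), (F ω).offspring c = x c}, ← ENNReal.tsum_mul_right]
  refine tsum_congr fun T => ?_
  rcases Set.eq_empty_or_nonempty ((fun ω => ((F ω).finite_pattern (n + 1)).toFinset) ⁻¹' {T} ∩
    {ω | ∀ c ∈ lowerLabels x (n + 1), (F ω).offspring c = x c}) with hemp | ⟨ω₀, hT, hω₀⟩
  · rw [hemp, measure_empty, zero_mul]
    refine measure_mono_null (fun ω hω => ?_) (measure_empty (μ := P))
    rw [← hemp]
    exact ⟨hω.1, fun c hc => hω.2 c (mem_lowerLabels_succ.2 (Or.inl hc))⟩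
  · set t := F ω₀ with ht
    have hagree : ∀ ω, ω ∈ (fun ω => ((F ω).finite_pattern (n + 1)).toFinset) ⁻¹' {T} ↔
        (F ω).AgreeUpTo t n := by
      intro ω
      rw [agreeUpTo_iff_pattern_eq, ← Set.Finite.toFinset_inj (hs := (F ω).finite_pattern (n + 1))
        (ht := t.finite_pattern (n + 1))]
      rw [Set.mem_preimage, Set.mem_singleton_iff] at hT ⊢
      rw [← hT]
    -- up to length `n + 1`, the labels of the forest are the labels of `x`
    have hlab : ∀ c : Label d, c.length ≤ n + 1 → (c ∈ t.labels ↔ c ∈ tree (fun _ => True) x) := by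
      have h1 : tree (fun c => c.length < n + 1) x =
          tree (fun c => c.length < n + 1) t.offspring := by
        refine tree_congr fun c hc hn => (hω₀ c (mem_lowerLabels.2 ⟨?_, hn⟩)).symm
        exact (mem_tree_length_lt_iff.1 hc).1
      intro c hc
      have h2 := mem_tree_length_lt_iff (ζ := x) (n := n + 1) (c := c)
      have h3 := mem_tree_length_lt_iff (ζ := t.offspring) (n := n + 1) (c := c)
      rw [and_iff_left hc] at h2 h3
      rw [← h2, h1, h3]
      rfl
    have hinner : ∀ ω, (F ω).AgreeUpTo t n → ∀ c ∈ lowerLabels x (n + 1),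
        (F ω).offspring c = x c := by
      intro ω hω c hc
      have hc' := mem_lowerLabels.1 hc
      rw [hω.offspring_eq ((hlab c hc'.2.le).2 hc'.1) (by omega)]
      exact hω₀ c hc
    have hinj := t.decode_injOn
    -- the child vectors prescribed by `x`, transported to planar labels
    let y : List ℕ → Fin d → ℕ := fun w => x (Function.invFunOn t.decode t.labels w)
    have hy : ∀ v : t.Vertex, y v.label = x v.code := by
      intro v
      show x _ = _
      rw [← v.decode_code, hinj.leftInvOn_invFunOn v.code_mem]
    have hlevel : ∀ ω, (F ω).AgreeUpTo t n →
        ((∀ c ∈ lowerLabels x (n + 2), (F ω).offspring c = x c) ↔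
          ∀ v : t.Vertex, v.label.length = n + 1 → (F ω).childVector v.label = y v.label) := by
      intro ω hω
      constructor
      · intro h v hv
        rw [← hω.offspring_eq_childVector v hv, hy]
        refine h _ (mem_lowerLabels_succ.2 (Or.inr (mem_level.2 ?_)))
        have hl : v.code.length = n + 1 := by rw [v.length_code, hv]
        exact ⟨(hlab _ hl.le).1 v.code_mem, hl⟩
      · intro h c hc
        rcases mem_lowerLabels_succ.1 hc with hc | hc
        · exact hinner ω hω c hc
        · have hc' := mem_level.1 hc
          obtain ⟨v, rfl⟩ := exists_code_eq ((hlab c hc'.2.le).2 hc'.1)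
            (by rintro rfl; simp at hc')
          have hv : v.label.length = n + 1 := by rw [← v.length_code, hc'.2]
          rw [hω.offspring_eq_childVector v hv, h v hv, hy]
    have e1 : (fun ω => ((F ω).finite_pattern (n + 1)).toFinset) ⁻¹' {T} ∩
        {ω | ∀ c ∈ lowerLabels x (n + 2), (F ω).offspring c = x c}
        = {ω | (F ω).AgreeUpTo t n ∧
            ∀ v : t.Vertex, v.label.length = n + 1 → (F ω).childVector v.label = y v.label} := by
      ext ω
      rw [Set.mem_inter_iff, hagree]
      exact and_congr_right fun hω => hlevel ω hω
    have e2 : (fun ω => ((F ω).finite_pattern (n + 1)).toFinset) ⁻¹' {T} ∩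
        {ω | ∀ c ∈ lowerLabels x (n + 1), (F ω).offspring c = x c} = {ω | (F ω).AgreeUpTo t n} := by
      ext ω
      rw [Set.mem_inter_iff, hagree]
      exact ⟨fun h => h.1, fun h => ⟨h, hinner ω h⟩⟩
    rw [e1, e2, hF.branching n t y]
    congr 1
    rw [← finprod_mem_coe_finset]
    refine finprod_mem_eq_of_bijOn Vertex.code ⟨?_, Vertex.code_injective.injOn, ?_⟩ ?_
    · intro v hv
      have hl : v.code.length = n + 1 := by rw [v.length_code]; exact hv
      exact mem_level.2 ⟨(hlab _ hl.le).1 v.code_mem, hl⟩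
    · intro c hc
      have hc' := mem_level.1 hc
      obtain ⟨v, rfl⟩ := exists_code_eq ((hlab c hc'.2.le).2 hc'.1) (by rintro rfl; simp at hc')
      exact ⟨v, by rw [Set.mem_ofPred_eq, ← v.length_code, hc'.2], rfl⟩
    · intro v _
      rw [hy, offspringLaw_of_type v.type_code]

theorem measure_offspring_eq [IsProbabilityMeasure P] (hF : IsMBGWForest P φ r F)
    (x : Label d → Fin d → ℕ) (n : ℕ) :
    P {ω | ∀ c ∈ lowerLabels x n, (F ω).offspring c = x c}
      = ∏ c ∈ lowerLabels x n, offspringLaw φ r c {x c} := by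
  rcases n with _ | n
  · have : lowerLabels x 0 = ∅ := by ext c; simp [mem_lowerLabels]
    rw [this]
    simp
  induction n with
  | zero =>
    have h1 : lowerLabels x 1 = {[]} := by
      ext c
      rw [mem_lowerLabels, Finset.mem_singleton, Nat.lt_one_iff, List.length_eq_zero_iff]
      exact ⟨fun h => h.2, by rintro rfl; simp⟩
    have h2 : ∀ᵐ ω ∂P, (F ω).offspring [] = r := by
      filter_upwards [hF.roots] with ω hω
      exact funext hω
    rw [h1, Finset.prod_singleton, offspringLaw]
    simp only [Finset.mem_singleton, forall_eq]
    rw [Measure.dirac_apply' _ (measurableSet_singleton _)]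
    by_cases hr : r = x []
    · rw [Set.indicator_of_mem (by simp [hr])]
      have : ∀ᵐ ω ∂P, (F ω).offspring [] = x [] := by
        filter_upwards [h2] with ω hω
        rw [hω, hr]
      rw [measure_congr (t := Set.univ) (Filter.eventuallyEq_univ.2 this), measure_univ]
      rfl
    · rw [Set.indicator_of_notMem (by simpa using hr)]
      refine measure_mono_null (t := {ω | ¬ (F ω).offspring [] = r}) (fun ω hω hω' => ?_) h2
      exact hr (hω'.symm.trans hω)
  | succ n ih => rw [hF.measure_branching, ih, ← prod_lowerLabels_succ]

theorem measurableSet_truncate (hF : IsMBGWForest P φ r F) (n : ℕ) (W : Finset (Label d)) :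
    MeasurableSet ((fun ω => truncate (F ω).offspring n) ⁻¹' {W}) := by
  refine hF.measurableSet_of_pattern n fun ω ω' h hω => ?_
  rw [Set.mem_preimage, Set.mem_singleton_iff] at hω ⊢
  rw [← hω, ← Finset.coe_inj, coe_truncate, coe_truncate]
  refine tree_congr fun c hc hn => (h.offspring_eq ?_ hn.le).symm
  exact (mem_tree_length_lt_iff.1 hc).1

theorem measure_truncate [IsProbabilityMeasure P] [∀ i, IsProbabilityMeasure (φ i)]
    (hF : IsMBGWForest P φ r F) (n : ℕ) (W : Finset (Label d)) :
    P ((fun ω => truncate (F ω).offspring n) ⁻¹' {W})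
      = Measure.infinitePi (offspringLaw φ r) ((fun ζ => truncate ζ n) ⁻¹' {W}) := by
  have e0 : ∀ ζ : Label d → Fin d → ℕ, truncate ζ n = W ↔ tree (fun c => c.length < n) ζ = W :=
    fun ζ => truncate_eq_iff
  have e1 : (fun ζ : Label d → Fin d → ℕ => truncate ζ n) ⁻¹' {W}
      = {ζ | tree (fun c => c.length < n) ζ = W} := by ext ζ; exact e0 ζ
  rw [e1]
  by_cases hW : tree (fun c => c.length < n) (childCount W) = W
  · have e3 : lowerLabels (childCount W) n = W.filter fun c => c.length < n := by
      rw [lowerLabels, truncate_eq_iff.2 hW]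
    rw [infinitePi_tree_eq φ r hW, weight]
    have e2 : (fun ω => truncate (F ω).offspring n) ⁻¹' {W}
        = {ω | ∀ c ∈ lowerLabels (childCount W) n, (F ω).offspring c = childCount W c} := by
      ext ω
      rw [Set.mem_preimage, Set.mem_singleton_iff, e0, tree_eq_iff, and_iff_right hW, e3]
      simp only [Finset.mem_filter, Set.mem_ofPred_eq, and_imp]
    rw [e2, hF.measure_offspring_eq, e3]
    congr!
  · have e2 : (fun ω => truncate (F ω).offspring n) ⁻¹' {W} = ∅ := by
      ext ω
      simp only [Set.mem_preimage, Set.mem_singleton_iff, e0, Set.mem_empty_iff_false, iff_false]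
      exact fun h => hW (tree_eq_iff.1 h).1
    have e3 : {ζ : Label d → Fin d → ℕ | tree (fun c => c.length < n) ζ = W} = ∅ := by
      ext ω
      simp only [Set.mem_ofPred_eq, Set.mem_empty_iff_false, iff_false]
      exact fun h => hW (tree_eq_iff.1 h).1
    rw [e2, e3, measure_empty, measure_empty]

/-- The truncation of the forest equals `S` with the same probability as for independent child
vectors. -/
theorem measurableSet_and_measure_tree_eq [IsProbabilityMeasure P]
    [∀ i, IsProbabilityMeasure (φ i)] (hF : IsMBGWForest P φ r F) (p : Label d → Prop)
    (S : Finset (Label d)) (hS : tree p (childCount S) = S) :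
    MeasurableSet {ω | tree p (F ω).offspring = S} ∧
      P {ω | tree p (F ω).offspring = S} = weight φ r p S := by
  obtain ⟨n, hn⟩ : ∃ n, ∀ c ∈ S, c.length < n :=
    ⟨S.sup List.length + 1, fun c hc => Nat.lt_succ_of_le (Finset.le_sup (f := List.length) hc)⟩
  constructor
  · refine measurableSet_of_determined (hF.measurableSet_truncate n) fun ω ω' h hω => ?_
    have h1 := (tree_childCount_truncate hn).2 hω
    rw [show truncate (F ω).offspring n = truncate (F ω').offspring n from h] at h1
    exact (tree_childCount_truncate hn).1 h1
  · have hm : ∀ W : Finset (Label d), MeasurableSet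
        ((fun ζ : Label d → Fin d → ℕ => truncate ζ n) ⁻¹' {W}) := by
      intro W
      have : (fun ζ : Label d → Fin d → ℕ => truncate ζ n) ⁻¹' {W}
          = {ζ | tree (fun c => c.length < n) ζ = W} := by ext ζ; exact truncate_eq_iff
      rw [this]
      exact measurableSet_tree_eq _ _
    rw [← infinitePi_tree_eq φ r hS,
      measure_eq_tsum_preimage_inter P (hF.measurableSet_truncate n),
      measure_eq_tsum_preimage_inter (Measure.infinitePi (offspringLaw φ r)) hm]
    refine tsum_congr fun W => ?_
    by_cases hW : tree p (childCount W) = S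
    · have e1 : (fun ω => truncate (F ω).offspring n) ⁻¹' {W} ∩ {ω | tree p (F ω).offspring = S}
          = (fun ω => truncate (F ω).offspring n) ⁻¹' {W} := by
        refine Set.inter_eq_left.2 fun ω hω => (tree_childCount_truncate hn).1 ?_
        rw [Set.mem_preimage, Set.mem_singleton_iff] at hω
        rw [hω, hW]
      have e2 : (fun ζ : Label d → Fin d → ℕ => truncate ζ n) ⁻¹' {W} ∩ {ζ | tree p ζ = S}
          = (fun ζ => truncate ζ n) ⁻¹' {W} := by
        refine Set.inter_eq_left.2 fun ω hω => (tree_childCount_truncate hn).1 ?_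
        rw [Set.mem_preimage, Set.mem_singleton_iff] at hω
        rw [hω, hW]
      rw [e1, e2, hF.measure_truncate]
    · have e1 : (fun ω => truncate (F ω).offspring n) ⁻¹' {W} ∩ {ω | tree p (F ω).offspring = S}
          = ∅ := by
        refine Set.eq_empty_of_forall_notMem fun ω hω => hW ?_
        have h1 : truncate (F ω).offspring n = W := hω.1
        rw [← h1]
        exact (tree_childCount_truncate hn).2 hω.2
      have e2 : (fun ζ : Label d → Fin d → ℕ => truncate ζ n) ⁻¹' {W} ∩ {ζ | tree p ζ = S} = ∅ := by
        refine Set.eq_empty_of_forall_notMem fun ζ hω => hW ?_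
        have h1 : truncate ζ n = W := hω.1
        rw [← h1]
        exact (tree_childCount_truncate hn).2 hω.2
      rw [e1, e2, measure_empty, measure_empty]

end IsMBGWForest

/-! ### Equality of laws from matching partitions -/

section IdentDistrib

variable {Ω Ω' ι κ β : Type*} [MeasurableSpace Ω] [MeasurableSpace Ω']
  [Countable κ]

theorem aemeasurable_of_partition [MeasurableSpace β] {P : Measure Ω} {f : Ω → β} {A : κ → Set Ω}
    {v : κ → β} (hA : ∀ k, MeasurableSet (A k)) (hcov : ∀ᵐ ω ∂P, ω ∈ ⋃ k, A k)
    (hf : ∀ k, ∀ ω ∈ A k, f ω = v k) : AEMeasurable f P := by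
  rw [← Measure.restrict_eq_self_of_ae_mem hcov, aemeasurable_iUnion_iff]
  intro k
  refine (aemeasurable_const (b := v k)).congr ?_
  filter_upwards [ae_restrict_mem (hA k)] with ω hω
  exact (hf k ω hω).symm

theorem measure_preimage_eq_tsum_of_partition {P : Measure Ω} {f : Ω → β} {A : κ → Set Ω}
    {v : κ → β} (hA : ∀ k, MeasurableSet (A k)) (hdisj : Pairwise (Function.onFun Disjoint A))
    (hcov : ∀ᵐ ω ∂P, ω ∈ ⋃ k, A k) (hf : ∀ k, ∀ ω ∈ A k, f ω = v k) (s : Set β) :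
    P (f ⁻¹' s) = ∑' k, (v ⁻¹' s).indicator (fun k => P (A k)) k := by
  classical
  rw [← Measure.restrict_eq_self_of_ae_mem hcov, Measure.restrict_iUnion hdisj hA,
    Measure.sum_apply_of_countable]
  refine tsum_congr fun k => ?_
  rw [Measure.restrict_apply' (hA k), Set.indicator_apply]
  split_ifs with hk
  · rw [Measure.restrict_iUnion hdisj hA |>.symm, Measure.restrict_eq_self_of_ae_mem hcov]
    congr 1
    exact Set.inter_eq_right.2 fun ω hω => by rw [Set.mem_preimage, hf k ω hω]; exact hk
  · refine measure_mono_null (fun ω hω => ?_) measure_empty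
    apply hk
    rw [Set.mem_preimage, ← hf k ω hω.2]
    exact hω.1

/-- Two functions with the same constant values on matching countable partitions have the same law. -/
theorem identDistrib_of_partition [MeasurableSpace β] {P : Measure Ω} {Q : Measure Ω'} {f : Ω → β}
    {g : Ω' → β} {A : κ → Set Ω} {B : κ → Set Ω'} {v : κ → β}
    (hA : ∀ k, MeasurableSet (A k)) (hB : ∀ k, MeasurableSet (B k))
    (hAdisj : Pairwise (Function.onFun Disjoint A)) (hBdisj : Pairwise (Function.onFun Disjoint B))
    (hAcov : ∀ᵐ ω ∂P, ω ∈ ⋃ k, A k) (hBcov : ∀ᵐ ω ∂Q, ω ∈ ⋃ k, B k)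
    (hAB : ∀ k, P (A k) = Q (B k)) (hf : ∀ k, ∀ ω ∈ A k, f ω = v k)
    (hg : ∀ k, ∀ ω ∈ B k, g ω = v k) : IdentDistrib f g P Q := by
  have hfm := aemeasurable_of_partition hA hAcov hf
  have hgm := aemeasurable_of_partition hB hBcov hg
  refine ⟨hfm, hgm, Measure.ext fun s hs => ?_⟩
  rw [Measure.map_apply_of_aemeasurable hfm hs, Measure.map_apply_of_aemeasurable hgm hs,
    measure_preimage_eq_tsum_of_partition hA hAdisj hAcov hf,
    measure_preimage_eq_tsum_of_partition hB hBdisj hBcov hg]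
  simp_rw [hAB]

theorem identDistrib_pi_of_finset [Countable ι] {X : ι → Type*} [∀ i, MeasurableSpace (X i)]
    {P : Measure Ω} [IsFiniteMeasure P] {Q : Measure Ω'} [IsFiniteMeasure Q] {f : Ω → ∀ i, X i}
    {g : Ω' → ∀ i, X i}
    (h : ∀ I : Finset ι, IdentDistrib (fun ω (i : I) => f ω i) (fun ω (i : I) => g ω i) P Q) :
    IdentDistrib f g P Q := by
  have hfm : AEMeasurable f P := aemeasurable_pi_iff.2 fun i =>
    aemeasurable_pi_iff.1 (h {i}).aemeasurable_fst ⟨i, Finset.mem_singleton_self i⟩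
  have hgm : AEMeasurable g Q := aemeasurable_pi_iff.2 fun i =>
    aemeasurable_pi_iff.1 (h {i}).aemeasurable_snd ⟨i, Finset.mem_singleton_self i⟩
  refine ⟨hfm, hgm, ?_⟩
  refine IsProjectiveLimit.unique (P := fun I : Finset ι => (Q.map g).map I.restrict)
    (fun I => ?_) fun I => rfl
  show _ = (Q.map g).map I.restrict
  rw [AEMeasurable.map_map_of_aemeasurable (Finset.measurable_restrict I).aemeasurable hfm,
    AEMeasurable.map_map_of_aemeasurable (Finset.measurable_restrict I).aemeasurable hgm]
  exact (h I).map_eq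

end IdentDistrib

open Label MForest

theorem IsMBGWForest.ae_exists_tree_eq {d : ℕ} {φ : Fin d → Measure (Fin d → ℕ)}
    [∀ i, IsProbabilityMeasure (φ i)] (hφ : IsSubcritical φ) {r : Fin d → ℕ} {Ω : Type*}
    [MeasurableSpace Ω] {P : Measure Ω} [IsProbabilityMeasure P] {F : Ω → MForest d}
    (hF : IsMBGWForest P φ r F) (H : ℕ) :
    ∀ᵐ ω ∂P, ω ∈ ⋃ S : {S : Finset (Label d) // IsExplored r H S},
      {ω | tree (fun c => redHeight c ≤ H) (F ω).offspring = (S : Finset (Label d))} := by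
  have hm := fun S : {S : Finset (Label d) // IsExplored r H S} =>
    hF.measurableSet_and_measure_tree_eq _ _ S.2.1
  refine (mem_ae_iff_prob_eq_one (MeasurableSet.iUnion fun S => (hm S).1)).2 ?_
  rw [measure_iUnion _ fun S => (hm S).1]
  · rw [← tsum_weight_eq_one hφ r H]
    exact tsum_congr fun S => (hm S).2
  · intro S S' hne
    rw [Function.onFun, Set.disjoint_left]
    intro ω h h'
    exact hne (Subtype.ext (Finset.coe_injective (h.symm.trans h')))

theorem lemma3p1 {d : ℕ}
    (φ : Fin d → Measure (Fin d → ℕ)) [∀ i, IsProbabilityMeasure (φ i)]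
    (hφ : IsSubcritical φ)
    (r : Fin d → ℕ) (hr : r ≠ 0)
    -- the forest
    {Ω : Type*} [MeasurableSpace Ω] (P : Measure Ω) [IsProbabilityMeasure P]
    (F : Ω → MForest d) (hF : IsMBGWForest P φ r F)
    -- the independent coding walks, through their i.i.d. steps
    {Ω' : Type*} [MeasurableSpace Ω'] (Q : Measure Ω') [IsProbabilityMeasure Q]
    (ξ : Fin d → ℕ → Ω' → Fin d → ℕ)
    (hξ_meas : ∀ i k, Measurable (ξ i k))
    (hξ_law : ∀ i k, Q.map (ξ i k) = φ i)
    (hξ_indep : iIndepFun (fun p : Fin d × ℕ => ξ p.1 p.2) Q) :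
    -- almost surely, the vertex sets are finite
    (∀ᵐ ω ∂P, ∀ (h : ℕ) (j : Fin d),
      ((F ω).reducedUpTo h j).Finite ∧ ((F ω).verticesUpTo h j).Finite) ∧
    -- almost surely, all the hitting times are finite
    (∀ᵐ ω ∂Q, ∀ (i : Fin d) (m : ℕ),
      ∃ k : ℕ, CodingWalk.X (fun i k => ξ i k ω) i i k = -(m : ℤ)) ∧
    -- equality in law, jointly over all heights and types
    IdentDistrib
      (fun ω (p : ℕ × Fin d) =>
        ((((F ω).reducedUpTo p.1 p.2).ncard : ℤ), ((F ω).verticesUpTo p.1 p.2).ncard))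
      (fun ω (p : ℕ × Fin d) =>
        (CodingWalk.R (fun i k => ξ i k ω) r p.1 p.2,
          CodingWalk.U (fun i k => ξ i k ω) r p.1 p.2))
      P Q := by
  refine ⟨?_, ae_exists_hitting hφ hξ_meas hξ_law hξ_indep, ?_⟩
  · refine ae_all_iff.2 fun h => ?_
    filter_upwards [hF.ae_exists_tree_eq hφ h] with ω hω j
    obtain ⟨S, hS⟩ := Set.mem_iUnion.1 hω
    exact ⟨(reducedUpTo_of_tree_eq hS le_rfl j).1, (verticesUpTo_of_tree_eq hS le_rfl j).1⟩
  · refine identDistrib_pi_of_finset fun I => ?_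
    obtain ⟨H, hH⟩ : ∃ H, ∀ p ∈ I, p.1 ≤ H :=
      ⟨I.sup Prod.fst, fun p hp => Finset.le_sup (f := Prod.fst) hp⟩
    have hm := fun S : {S : Finset (Label d) // IsExplored r H S} =>
      hF.measurableSet_and_measure_tree_eq _ _ S.2.1
    refine identDistrib_of_partition (κ := {S : Finset (Label d) // IsExplored r H S})
      (B := fun S => {ω | Reads (fun i k => ξ i k ω) H S})
      (v := fun S p => (((tops S p.1.1 p.1.2).card : ℤ), (verts S p.1.1 p.1.2).card))
      (fun S => (hm S).1) (fun S => measurableSet_reads hξ_meas H S) ?_ ?_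
      (hF.ae_exists_tree_eq hφ H) ?_ ?_ ?_ ?_
    · intro S S' hne
      rw [Function.onFun, Set.disjoint_left]
      intro ω h h'
      exact hne (Subtype.ext (Finset.coe_injective (h.symm.trans h')))
    · intro S S' hne
      rw [Function.onFun, Set.disjoint_left]
      intro ω h h'
      exact hne (Subtype.ext (IsExplored.eq_of_reads (ξ := fun i k => ξ i k ω) S.2 S'.2 h h'))
    · filter_upwards [ae_exists_reads hφ hξ_meas hξ_law hξ_indep r H] with ω hω
      exact Set.mem_iUnion.2 hω
    · exact fun S => (hm S).2.trans (measure_reads hξ_meas hξ_law hξ_indep S.2).symm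
    · rintro S ω hω
      funext ⟨p, hp⟩
      dsimp only
      rw [(reducedUpTo_of_tree_eq hω (hH p hp) p.2).2, (verticesUpTo_of_tree_eq hω (hH p hp) p.2).2]
    · rintro S ω hω
      have hω : Reads (fun i k => ξ i k ω) H S := hω
      funext ⟨p, hp⟩
      dsimp only
      rw [S.2.R_eq hω (hH p hp), S.2.U_eq hω (hH p hp)]
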